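/- Let $X$ be an irreducible smooth affine algebraic curve over $\mathbb{C}$, with coordinate ring $\mathcal{O}(X)$, and let $\mathcal{O}(T^*X) = \operatorname{Sym}_{\mathcal{O}(X)}(\operatorname{Der}_{\mathbb{C}}\mathcal{O}(X))$ be the ring of functions on its cotangent bundle. Let $G_0(T^*X)$ and $K_0(T^*X)$ be the Grothendieck groups of finitely generated, respectively finitely generated projective, $\mathcal{O}(T^*X)$-modules. For an $\mathcal{O}(T^*X)$-module $M$ write $M^* = \operatorname{Hom}_{\mathcal{O}(T^*X)}(M, \mathcal{O}(T^*X))$. Let $F$ be a nonzero ideal of $\mathcal{O}(T^*X)$, let $I$ be a nonzero ideal of $\mathcal{O}(X)$, and let $I\mathcal{O}(T^*X)$ be the ideal of $\mathcal{O}(T^*X)$ generated by $I$. Then $F$ is finitely generated, the modules $F^{**}$ and $I\mathcal{O}(T^*X)$ are invertible, and the following are equivalent: 1. $F$ and $I\mathcal{O}(T^*X)$ have the same class in $G_0(T^*X)$; 2. $F^{**}$ and $I\mathcal{O}(T^*X)$ have the same class in $K_0(T^*X)$; 3. $F^{**}$ and $I\mathcal{O}(T^*X)$ have the same class in $\operatorname{Pic}(T^*X)$;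 4. there is an injective $\mathcal{O}(T^*X)$-linear map $F \to I\mathcal{O}(T^*X)$ whose cokernel is finite-dimensional over $\mathbb{C}$. -/

import Mathlib

universe u

/-- The Grothendieck group of a class `P` of modules over a ring `R`: the free abelian group on the
modules satisfying `P`, modulo `[N] = [M] + [L]` for every short exact sequence
`0 → M → N → L → 0` of modules satisfying `P`. -/
def ModuleGrothendieckGroup (R : Type u) [CommRing R] (P : ModuleCat.{u} R → Prop) : Type (u + 1) :=
  FreeAbelianGroup {M : ModuleCat.{u} R // P M} ⧸
    AddSubgroup.closure {x : FreeAbelianGroup {M : ModuleCat.{u} R // P M} |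
      ∃ (M N L : {M : ModuleCat.{u} R // P M}) (f : M.1 →ₗ[R] N.1) (g : N.1 →ₗ[R] L.1),
        Function.Injective f ∧ Function.Exact f g ∧ Function.Surjective g ∧
          x = FreeAbelianGroup.of N - (FreeAbelianGroup.of M + FreeAbelianGroup.of L)}

noncomputable instance (R : Type u) [CommRing R] (P : ModuleCat.{u} R → Prop) :
    AddCommGroup (ModuleGrothendieckGroup R P) :=
  inferInstanceAs (AddCommGroup (_ ⧸ AddSubgroup.closure _))

/-- The class `[M]` in the Grothendieck group of a module `M` satisfying `P`. -/
def ModuleGrothendieckGroup.mk (R : Type u) [CommRing R] (P : ModuleCat.{u} R → Prop)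
    (M : ModuleCat.{u} R) (hM : P M) : ModuleGrothendieckGroup R P :=
  QuotientAddGroup.mk (FreeAbelianGroup.of ⟨M, hM⟩)

/-- `G₀` of an affine scheme `Spec R`: the Grothendieck group of finitely generated `R`-modules. -/
abbrev G0 (R : Type u) [CommRing R] : Type (u + 1) :=
  ModuleGrothendieckGroup R fun M => Module.Finite R M

/-- The class `[M] ∈ G₀(R)` of a finitely generated `R`-module `M`. -/
def G0.mk (R : Type u) [CommRing R] (M : Type u) [AddCommGroup M] [Module R M]
    [hM : Module.Finite R M] : G0 R :=
  ModuleGrothendieckGroup.mk R _ (ModuleCat.of R M) hM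

/-- `K₀` of an affine scheme `Spec R`: the Grothendieck group of finitely generated projective
`R`-modules. -/
abbrev K0 (R : Type u) [CommRing R] : Type (u + 1) :=
  ModuleGrothendieckGroup R fun M => Module.Finite R M ∧ Module.Projective R M

/-- The class `[M] ∈ K₀(R)` of a finitely generated projective `R`-module `M`. -/
def K0.mk (R : Type u) [CommRing R] (M : Type u) [AddCommGroup M] [Module R M]
    [hM : Module.Finite R M] [hM' : Module.Projective R M] : K0 R :=
  ModuleGrothendieckGroup.mk R _ (ModuleCat.of R M) ⟨hM, hM'⟩

/-- The ring `𝒪(T*X)` of functions on the cotangent bundle of a smooth affine complex variety `X`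
with coordinate ring `A = 𝒪(X)`: the symmetric algebra over `A` of the module of vector fields
`Der_ℂ(A)`. -/
abbrev CotangentRing (A : Type u) [CommRing A] [Algebra ℂ A] : Type u :=
  SymmetricAlgebra A (Derivation ℂ A A)

/-!
Let `R` be the ring of functions on the cotangent bundle of the curve. Three properties of the
surface `Spec R` carry the proof: its local rings are unique factorization domains, its closed
points have height two, and the residue field of a closed point has trivial class in `G₀(R)`. They
hold since `R = Sym_A(Der A)` with `Der A` invertible over the Dedekind domain `A`: over a local
ring `B` of the curve `R` becomes `B[X]`, a polynomial ring over a discrete valuation ring, and the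
fibre through a closed point is an affine line, in which the point is a principal divisor
(`SymmetricAlgebra.isLocallyFactorial`, `SymmetricAlgebra.height_of_isMaximal`,
`SymmetricAlgebra.G0_mk_quotient_eq_zero`).

That `A` is Dedekind and `Der A` invertible (`isDedekindDomain_of_smooth`,
`invertible_derivation_of_smooth`) comes down to the Kähler differentials having rank one. The curve
is a finite cover of the affine line, and this cover is generically étale, so its differentials
have the rank of those of the line. The cotangent space at a point embeds in the fibre of the
differentials, so it is at most one-dimensional, and the local ring is a discrete valuation ring.

The equivalence is proved for any surface with the three properties, with an invertible ideal `J` in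
place of the extension of `I` (`tfae_of_isLocallyFactorial`). For `0 ≠ d ∈ F`, the double dual of
`F` is the ideal `E = (d) : ((d) : F)`. Since a finitely generated ideal has a greatest common
divisor in a unique factorization domain, `E` is invertible (`Ideal.colon_colon_mul_colon`), and it
agrees with `F` at all points of codimension one. So `E / F` is supported at finitely many closed
points: it is finite-dimensional and has trivial class in `G₀`. Hence an isomorphism `E ≃ J`
restricts to an injection of `F` into `J` with finite-dimensional cokernel, and `[F] = [E]` in `G₀`.
Conversely, such an injection is bijective on duals
(`dualMap_bijective_of_forall_mem_dvrPrimes`), so it induces an isomorphism of `F**` with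
`J** = J`.

It remains to see that `[E] = [J]` in `G₀` implies `E ≃ J`; then the same holds for `K₀`, which maps
to `G₀`. For this, a first Chern class on `G₀` is constructed by hand (`G0.divisorClass`). A
finitely generated module contains a free submodule with torsion quotient, and the divisor of that
quotient, formed with lengths at the codimension one points, is modulo principal divisors
independent of the choice: two choices are connected by a chain of exchanges of one basis element
(`IsFullBasis.torsionClass_eq`), and one exchange changes the divisor by a principal one. So if `[E]
= [J]`, then `a E` and `b J` have the same divisor for some nonzero `a` and `b`, and invertible
ideals with the same divisor are equal, because `R` is the intersection of its localizations at the
codimension one points (`dvd_of_forall_mem_dvrPrimes`).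
-/

section

open Module
open scoped Pointwise

/-! ### Divisibility in locally factorial domains -/

/-- A commutative ring is locally factorial if its localizations at maximal ideals are unique
factorization domains. -/
class IsLocallyFactorial (R : Type u) [CommRing R] : Prop where
  ufm (m : Ideal R) [m.IsMaximal] : UniqueFactorizationMonoid (Localization.AtPrime m)

/-- The primes of a domain whose local ring is a discrete valuation ring: the codimension one
points at which the ring is regular. -/
def dvrPrimes (R : Type u) [CommRing R] [IsDomain R] : Set (PrimeSpectrum R) :=
  {Q | IsDiscreteValuationRing (Localization.AtPrime Q.asIdeal)}

section LocallyFactorial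

/-- Every element of the local ring at a prime is associated to an element of the ring. -/
theorem exists_associated_algebraMap_atPrime {R : Type u} [CommRing R] (m : Ideal R) [m.IsPrime]
    (x : Localization.AtPrime m) :
    ∃ r : R, Associated x (algebraMap R (Localization.AtPrime m) r) := by
  obtain ⟨⟨r, s⟩, hr⟩ := IsLocalization.surj m.primeCompl x
  exact ⟨r, (IsLocalization.map_units (Localization.AtPrime m) s).unit, hr⟩

variable {R : Type u} [CommRing R] [IsDomain R]

theorem height_eq_one_of_mem_dvrPrimes {Q : PrimeSpectrum R} (hQ : Q ∈ dvrPrimes R) :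
    Q.asIdeal.height = 1 := by
  have hQ : IsDiscreteValuationRing (Localization.AtPrime Q.asIdeal) := hQ
  have h := IsLocalization.AtPrime.ringKrullDim_eq_height Q.asIdeal
    (Localization.AtPrime Q.asIdeal)
  rw [IsDiscreteValuationRing.ringKrullDim_eq_one] at h
  exact_mod_cast h.symm

/-- If every element of a nonzero prime `Q` is, up to multiplication by elements outside `Q`, a
multiple of one fixed element, then the local ring at `Q` is a discrete valuation ring. -/
theorem mem_dvrPrimes_of_forall_exists_dvd [IsNoetherianRing R] (Q : PrimeSpectrum R)
    (h0 : Q.asIdeal ≠ ⊥) (q : R) (hq : q ∈ Q.asIdeal)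
    (h : ∀ x ∈ Q.asIdeal, ∃ s ∉ Q.asIdeal, q ∣ s * x) : Q ∈ dvrPrimes R := by
  have hnf : ¬ IsField (Localization.AtPrime Q.asIdeal) := by
    rw [IsLocalRing.isField_iff_maximalIdeal_eq, ← Localization.AtPrime.map_eq_maximalIdeal,
      Ideal.map_eq_bot_iff_of_injective]
    · exact h0
    · exact IsLocalization.injective _ Q.asIdeal.primeCompl_le_nonZeroDivisors
  refine ((IsDiscreteValuationRing.TFAE (Localization.AtPrime Q.asIdeal) hnf).out 0 4).2
    (show Submodule.IsPrincipal _ from ⟨⟨algebraMap _ _ q, ?_⟩⟩)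
  rw [← Localization.AtPrime.map_eq_maximalIdeal]
  apply le_antisymm
  · rw [Ideal.map_le_iff_le_comap]
    intro x hx
    obtain ⟨s, hs, c, hc⟩ := h x hx
    have hu : IsUnit (algebraMap R (Localization.AtPrime Q.asIdeal) s) :=
      IsLocalization.map_units _ (⟨s, hs⟩ : Q.asIdeal.primeCompl)
    rw [Ideal.mem_comap, Ideal.submodule_span_eq, Ideal.mem_span_singleton,
      ← hu.dvd_mul_left, ← map_mul, hc, map_mul]
    exact dvd_mul_right _ _
  · rw [Ideal.submodule_span_eq, Ideal.span_singleton_le_iff_mem]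
    exact Ideal.mem_map_of_mem _ hq

/-- Divisibility in the local ring at a prime, in terms of the ring. -/
theorem algebraMap_dvd_algebraMap_atPrime_iff (m : Ideal R) [m.IsPrime] (a b : R) :
    algebraMap R (Localization.AtPrime m) a ∣ algebraMap R (Localization.AtPrime m) b ↔
      ∃ s ∉ m, a ∣ s * b := by
  constructor
  · rintro ⟨c, hc⟩
    obtain ⟨⟨r, s⟩, hr⟩ := IsLocalization.surj m.primeCompl c
    refine ⟨s, s.2, r, ?_⟩
    apply IsLocalization.injective (Localization.AtPrime m) m.primeCompl_le_nonZeroDivisors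
    dsimp only at hr
    rw [map_mul, map_mul, hc, ← hr]
    ring
  · rintro ⟨s, hs, h⟩
    have hu : IsUnit (algebraMap R (Localization.AtPrime m) s) :=
      IsLocalization.map_units _ (⟨s, hs⟩ : m.primeCompl)
    rw [← hu.dvd_mul_left, ← map_mul]
    exact map_dvd _ h

/-- A prime element `q` of the local ring at `m` cuts out a codimension one regular point. -/
theorem comap_span_prime_mem_dvrPrimes [IsNoetherianRing R] (m : Ideal R) [m.IsPrime] (q : R)
    (hq : Prime (algebraMap R (Localization.AtPrime m) q)) :
    ∃ Q ∈ dvrPrimes R, ∀ x, x ∈ Q.asIdeal ↔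
      algebraMap R (Localization.AtPrime m) q ∣ algebraMap R (Localization.AtPrime m) x := by
  have hP : (Ideal.span {algebraMap R (Localization.AtPrime m) q}).IsPrime :=
    (Ideal.span_singleton_prime hq.ne_zero).2 hq
  let Q : PrimeSpectrum R := ⟨(Ideal.span {algebraMap R (Localization.AtPrime m) q}).comap
    (algebraMap R (Localization.AtPrime m)), inferInstance⟩
  have hmem : ∀ x, x ∈ Q.asIdeal ↔
      algebraMap R (Localization.AtPrime m) q ∣ algebraMap R (Localization.AtPrime m) x := by
    intro x
    change algebraMap R (Localization.AtPrime m) x ∈ Ideal.span _ ↔ _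
    rw [Ideal.mem_span_singleton]
  have hqQ : q ∈ Q.asIdeal := (hmem q).2 dvd_rfl
  refine ⟨Q, mem_dvrPrimes_of_forall_exists_dvd Q ?_ q hqQ ?_, hmem⟩
  · intro h
    rw [h, Ideal.mem_bot] at hqQ
    exact hq.ne_zero (by rw [hqQ, map_zero])
  · intro x hx
    obtain ⟨s, hs, h⟩ := (algebraMap_dvd_algebraMap_atPrime_iff m q x).1 ((hmem x).1 hx)
    refine ⟨s, fun hsQ => ?_, h⟩
    exact hq.not_isUnit (isUnit_of_dvd_unit ((hmem s).1 hsQ)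
      (IsLocalization.map_units _ (⟨s, hs⟩ : m.primeCompl)))

/-- A locally factorial Noetherian domain is the intersection of its localizations at the primes
whose local ring is a discrete valuation ring. -/
theorem dvd_of_forall_mem_dvrPrimes [IsNoetherianRing R] [IsLocallyFactorial R] {a b : R}
    (hb : b ≠ 0) (h : ∀ Q ∈ dvrPrimes R, ∃ s ∉ Q.asIdeal, b ∣ s * a) : b ∣ a := by
  by_contra hba
  -- At a maximal ideal over the denominators of `a / b`, write this fraction in lowest terms: a
  -- prime factor of its denominator gives a point of `dvrPrimes R` where it has a pole.
  obtain ⟨m, hm, hle⟩ := Ideal.exists_le_maximal ((Ideal.span {b}).colon {a}) (by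
    rw [Ideal.ne_top_iff_one, Submodule.mem_colon]
    simpa [Ideal.mem_span_singleton] using hba)
  have := IsLocallyFactorial.ufm m
  obtain ⟨a', b', c, hrel, ha, hb'⟩ := UniqueFactorizationMonoid.exists_reduced_factors'
    (algebraMap R (Localization.AtPrime m) a) (algebraMap R (Localization.AtPrime m) b) (by
      rwa [Ne, IsLocalization.to_map_eq_zero_iff _ m.primeCompl_le_nonZeroDivisors])
  have hinj := IsLocalization.injective (Localization.AtPrime m) m.primeCompl_le_nonZeroDivisors
  have hc : c ≠ 0 := by
    rintro rfl
    rw [zero_mul] at hb'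
    exact hb (hinj (by rw [← hb', map_zero]))
  have hb0 : b' ≠ 0 := by
    rintro rfl
    rw [mul_zero] at hb'
    exact hb (hinj (by rw [← hb', map_zero]))
  by_cases hu : IsUnit b'
  · obtain ⟨s, hs, hd⟩ := (algebraMap_dvd_algebraMap_atPrime_iff m b a).1
      (by rw [← ha, ← hb']; exact mul_dvd_mul_left c hu.dvd)
    exact hs (hle (by rw [Submodule.mem_colon]; simpa [Ideal.mem_span_singleton] using hd))
  · obtain ⟨π, hπ, hπb⟩ := WfDvdMonoid.exists_irreducible_factor hu hb0
    rw [UniqueFactorizationMonoid.irreducible_iff_prime] at hπ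
    obtain ⟨q, hq⟩ := exists_associated_algebraMap_atPrime m π
    obtain ⟨Q, hQ, hmem⟩ := comap_span_prime_mem_dvrPrimes m q (hq.prime hπ)
    obtain ⟨s, hs, d, hd⟩ := h Q hQ
    apply hs
    rw [hmem, ← hq.dvd_iff_dvd_left]
    have hd' : algebraMap R (Localization.AtPrime m) s * a' =
        b' * algebraMap R (Localization.AtPrime m) d := by
      apply mul_left_cancel₀ hc
      have := congrArg (algebraMap R (Localization.AtPrime m)) hd
      rw [map_mul, map_mul, ← ha, ← hb'] at this
      linear_combination this
    refine (hπ.dvd_or_dvd (hd' ▸ hπb.mul_right _)).resolve_right fun hπa => ?_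
    exact hπ.not_isUnit (hrel hπa hπb)

/-- In a locally factorial Noetherian domain all of whose maximal ideals have height two, the local
ring at a nonzero nonmaximal prime is a discrete valuation ring. -/
theorem mem_dvrPrimes_of_not_isMaximal [IsNoetherianRing R] [IsLocallyFactorial R]
    (hht : ∀ m : Ideal R, m.IsMaximal → m.height = 2) (P : PrimeSpectrum R)
    (h0 : P.asIdeal ≠ ⊥) (hP : ¬ P.asIdeal.IsMaximal) : P ∈ dvrPrimes R := by
  obtain ⟨m, hm, hle⟩ := Ideal.exists_le_maximal P.asIdeal P.isPrime.ne_top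
  have hlt : P.asIdeal < m := lt_of_le_of_ne hle (by rintro h; exact hP (h ▸ hm))
  have := IsLocallyFactorial.ufm m
  have hinj := IsLocalization.injective (Localization.AtPrime m) m.primeCompl_le_nonZeroDivisors
  have hdisj : Disjoint (m.primeCompl : Set R) P.asIdeal :=
    Set.disjoint_left.2 fun x hx hx' => hx (hle hx')
  have hPm : (P.asIdeal.map (algebraMap R (Localization.AtPrime m))).IsPrime :=
    IsLocalization.isPrime_of_isPrime_disjoint m.primeCompl _ _ P.isPrime hdisj
  obtain ⟨π, hπP, hπ⟩ := Ideal.IsPrime.exists_mem_prime_of_ne_bot hPm (by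
    rwa [Ne, Ideal.map_eq_bot_iff_of_injective hinj])
  obtain ⟨q, hq⟩ := exists_associated_algebraMap_atPrime m π
  obtain ⟨Q, hQ, hmem⟩ := comap_span_prime_mem_dvrPrimes m q (hq.prime hπ)
  -- The point `Q` cut out by a prime element of `P` has height one and lies in `P`, which has
  -- height less than two.
  have hQP : Q.asIdeal ≤ P.asIdeal := by
    intro x hx
    rw [hmem, ← hq.dvd_iff_dvd_left] at hx
    have : algebraMap R (Localization.AtPrime m) x ∈
      P.asIdeal.map (algebraMap R (Localization.AtPrime m)) := Ideal.mem_of_dvd _ hx hπP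
    rwa [← Ideal.mem_comap, ← Ideal.under_def, IsLocalization.under_map_of_isPrime_disjoint
      m.primeCompl _ P.isPrime hdisj] at this
  have h1 := height_eq_one_of_mem_dvrPrimes hQ
  suffices Q = P by rwa [← this]
  rcases hQP.eq_or_lt with h | h
  · exact PrimeSpectrum.ext h
  · have hm2 := hht m hm
    have h2 := Ideal.height_add_one_le_of_lt_of_isPrime h
    have h3 := Ideal.height_add_one_le_of_lt_of_isPrime hlt
    rw [h1] at h2
    rw [hm2] at h3
    have : (1 + 1 + 1 : ℕ∞) ≤ 2 := (add_le_add_left h2 1).trans h3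
    exact absurd this (by decide)

end LocallyFactorial

/-! ### Double duals of ideals -/

section DoubleDual

/-- If an element outside a prime `P` can be found for each element of a finitely generated
submodule `L` that multiplies it into `N`, then one such element works for all of `L`. -/
theorem exists_notMem_forall_smul_mem {R : Type*} [CommRing R] {M : Type*} [AddCommGroup M]
    [Module R M] {L N : Submodule R M} (hL : L.FG) (P : Ideal R) [P.IsPrime]
    (h : ∀ x ∈ L, ∃ s ∉ P, s • x ∈ N) : ∃ s ∉ P, ∀ x ∈ L, s • x ∈ N := by
  induction L, hL using Submodule.fg_induction with
  | singleton x =>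
    obtain ⟨s, hs, hx⟩ := h x (Submodule.mem_span_singleton_self x)
    refine ⟨s, hs, fun y hy => ?_⟩
    obtain ⟨r, rfl⟩ := Submodule.mem_span_singleton.1 hy
    rw [smul_comm]
    exact N.smul_mem r hx
  | sup L₁ L₂ _ _ h₁ h₂ =>
    obtain ⟨s₁, hs₁, hx₁⟩ := h₁ fun x hx => h x (Submodule.mem_sup_left hx)
    obtain ⟨s₂, hs₂, hx₂⟩ := h₂ fun x hx => h x (Submodule.mem_sup_right hx)
    refine ⟨s₁ * s₂, fun hs => (‹P.IsPrime›.mem_or_mem hs).elim hs₁ hs₂, fun x hx => ?_⟩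
    obtain ⟨y, hy, z, hz, rfl⟩ := Submodule.mem_sup.1 hx
    rw [smul_add]
    refine N.add_mem ?_ ?_
    · rw [mul_comm, mul_smul]
      exact N.smul_mem _ (hx₁ y hy)
    · rw [mul_smul]
      exact N.smul_mem _ (hx₂ z hz)

/-- A functional all of whose values are divisible by `d` can be divided by `d`. -/
theorem exists_eq_smul_of_forall_dvd {R : Type*} [CommRing R] [IsDomain R] {M : Type*}
    [AddCommGroup M] [Module R M] {d : R} (hd : d ≠ 0) (f : M →ₗ[R] R) (h : ∀ x, d ∣ f x) :
    ∃ g : M →ₗ[R] R, ∀ x, f x = d * g x := by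
  choose g hg using h
  refine ⟨{ toFun := g, map_add' := fun x y => ?_, map_smul' := fun r x => ?_ }, hg⟩
  · apply mul_left_cancel₀ hd
    rw [← hg, map_add, hg, hg, mul_add]
  · apply mul_left_cancel₀ hd
    rw [← hg, map_smul, hg, smul_eq_mul, smul_eq_mul, RingHom.id_apply]
    ring

/-- In a unique factorization domain a finitely generated ideal has a greatest common divisor, and
it is compatible with multiplication. -/
theorem Ideal.FG.exists_gcd {S : Type*} [CommRing S] [IsDomain S] [UniqueFactorizationMonoid S]
    {F : Ideal S} (hF : F.FG) :
    ∃ g, (∀ f ∈ F, g ∣ f) ∧ ∀ a b, (∀ f ∈ F, b ∣ a * f) → b ∣ a * g := by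
  classical
  let _ := (inferInstance : Nonempty (NormalizedGCDMonoid S)).some
  obtain ⟨t, rfl⟩ := hF
  refine ⟨t.gcd fun x => x, fun f hf => ?_, fun a b h => ?_⟩
  · rw [← Ideal.mem_span_singleton]
    refine Submodule.span_le.2 (fun x hx => ?_) hf
    exact Ideal.mem_span_singleton.2 (Finset.gcd_dvd (f := fun x => x) hx)
  · have h1 : b ∣ t.gcd fun x => a * x :=
      Finset.dvd_gcd fun x hx => h x (Submodule.subset_span hx)
    exact h1.trans (Finset.gcd_mul_left' t _ a).dvd

theorem Ideal.mem_span_singleton_colon {R : Type*} [CommRing R] {d r : R} {F : Ideal R} :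
    r ∈ (Ideal.span {d}).colon (F : Set R) ↔ ∀ f ∈ F, d ∣ r * f := by
  simp [Submodule.mem_colon, Ideal.mem_span_singleton]

theorem Ideal.self_mem_span_singleton_colon {R : Type*} [CommRing R] (d : R) (F : Ideal R) :
    d ∈ (Ideal.span {d}).colon (F : Set R) :=
  Ideal.mem_span_singleton_colon.2 fun _ _ => dvd_mul_right _ _

theorem Ideal.le_span_singleton_colon_colon {R : Type*} [CommRing R] (d : R) (F : Ideal R) :
    F ≤ (Ideal.span {d}).colon ((Ideal.span {d}).colon (F : Set R) : Set R) := fun f hf =>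
  Ideal.mem_span_singleton_colon.2 fun r hr => by
    rw [mul_comm]; exact Ideal.mem_span_singleton_colon.1 hr f hf

variable {R : Type u} [CommRing R] [IsDomain R]

/-- For a nonzero element `d` of an ideal `F` of a domain, evaluation at `d` identifies the dual of
`F` with the ideal `(d) : F`. -/
noncomputable def Ideal.dualEquivColon (F : Ideal R) {d : R} (hd : d ≠ 0) (hdF : d ∈ F) :
    Dual R F ≃ₗ[R] (Ideal.span {d}).colon (F : Set R) :=
  LinearEquiv.ofBijective
    (LinearMap.codRestrict _ (Dual.eval R F ⟨d, hdF⟩) fun φ =>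
      Ideal.mem_span_singleton_colon.2 fun f hf => ⟨φ ⟨f, hf⟩, by
        have h : f • (⟨d, hdF⟩ : F) = d • ⟨f, hf⟩ := Subtype.ext (mul_comm f d)
        rw [Dual.eval_apply, mul_comm, ← smul_eq_mul, ← map_smul, h, map_smul,
          smul_eq_mul]⟩) <| by
    constructor
    · rw [← LinearMap.ker_eq_bot, LinearMap.ker_eq_bot']
      intro φ hφ
      have hφ : φ ⟨d, hdF⟩ = 0 := congrArg Subtype.val hφ
      ext ⟨f, hf⟩
      apply mul_left_cancel₀ hd
      have h : f • (⟨d, hdF⟩ : F) = d • ⟨f, hf⟩ := Subtype.ext (mul_comm f d)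
      rw [← smul_eq_mul, ← map_smul, ← h, map_smul, hφ]
      simp
    · rintro ⟨r, hr⟩
      obtain ⟨g, hg⟩ := exists_eq_smul_of_forall_dvd hd (r • F.subtype) fun x =>
        Ideal.mem_span_singleton_colon.1 hr x x.2
      refine ⟨g, Subtype.ext ?_⟩
      apply mul_left_cancel₀ hd
      have := hg ⟨d, hdF⟩
      simp only [LinearMap.smul_apply, Submodule.subtype_apply, smul_eq_mul] at this
      simp only [LinearMap.codRestrict_apply, Dual.eval_apply]
      rw [← this, mul_comm]

/-- The double dual of a nonzero ideal `F`, as an ideal. -/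
noncomputable def Ideal.doubleDualEquiv (F : Ideal R) {d : R} (hd : d ≠ 0) (hdF : d ∈ F) :
    Dual R (Dual R F) ≃ₗ[R]
      (Ideal.span {d}).colon ((Ideal.span {d}).colon (F : Set R) : Set R) :=
  (F.dualEquivColon hd hdF).symm.dualMap ≪≫ₗ
    Ideal.dualEquivColon _ hd (Ideal.self_mem_span_singleton_colon d F)

theorem Ideal.invertible_of_mul_eq_span_singleton {J J' : Ideal R} {d : R} (hd : d ≠ 0)
    (h : J * J' = Ideal.span {d}) : Module.Invertible R J := by
  let K := FractionRing R
  have hd' : algebraMap R K d ≠ 0 := by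
    rwa [Ne, IsFractionRing.to_map_eq_zero_iff]
  have h1 : (J : FractionalIdeal (nonZeroDivisors R) K) *
      ((J' : FractionalIdeal (nonZeroDivisors R) K) *
        FractionalIdeal.spanSingleton _ (algebraMap R K d)⁻¹) = 1 := by
    rw [← mul_assoc, ← FractionalIdeal.coeIdeal_mul, h, FractionalIdeal.coeIdeal_span_singleton,
      FractionalIdeal.spanSingleton_mul_spanSingleton, mul_inv_cancel₀ hd',
      FractionalIdeal.spanSingleton_one]
  have h2 := congrArg (FractionalIdeal.coeSubmoduleHom (nonZeroDivisors R) K) h1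
  rw [map_mul, map_one] at h2
  let v : (Submodule R K)ˣ := ⟨_, _, h2, by rw [mul_comm]; exact h2⟩
  have : FaithfulSMul R K :=
    (faithfulSMul_iff_algebraMap_injective R K).2 (IsFractionRing.injective R K)
  have : Module.Invertible R (v : Submodule R K) := .left (Submodule.tensorInvEquiv v)
  have e : J ≃ₗ[R] (v : Submodule R K) :=
    Submodule.equivMapOfInjective (Algebra.linearMap R K) (IsFractionRing.injective R K) J
  exact .congr e.symm

/-- In a locally factorial Noetherian domain the double dual of a nonzero ideal is invertible: if
`g` is a greatest common divisor of `F` at a maximal ideal, then there `(d) : F = (d / g)` and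
`(d) : ((d) : F) = (g)`. -/
theorem Ideal.colon_colon_mul_colon [IsNoetherianRing R] [IsLocallyFactorial R] (F : Ideal R)
    {d : R} (hd : d ≠ 0) (hdF : d ∈ F) :
    (Ideal.span {d}).colon ((Ideal.span {d}).colon (F : Set R) : Set R) *
      (Ideal.span {d}).colon (F : Set R) = Ideal.span {d} := by
  set J' := (Ideal.span {d}).colon (F : Set R) with hJ'
  set J := (Ideal.span {d}).colon (J' : Set R) with hJ
  apply le_antisymm
  · rw [Ideal.mul_le]
    intro r hr s hs
    exact Ideal.mem_span_singleton.2 (Ideal.mem_span_singleton_colon.1 hr s hs)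
  · rw [Ideal.span_singleton_le_iff_mem]
    by_contra hcon
    obtain ⟨m, hm, hle⟩ := Ideal.exists_le_maximal ((J * J').colon {d}) (by
      rw [Ideal.ne_top_iff_one, Submodule.mem_colon]
      simpa using hcon)
    have := IsLocallyFactorial.ufm m
    have hFm : (F.map (algebraMap R (Localization.AtPrime m))).FG :=
      Ideal.FG.map (IsNoetherian.noetherian F) _
    obtain ⟨g', hg1, hg2⟩ := hFm.exists_gcd
    obtain ⟨g, hg⟩ := exists_associated_algebraMap_atPrime m g'
    have hgF : ∀ f ∈ F, ∃ s ∉ m, g ∣ s * f := fun f hf =>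
      (algebraMap_dvd_algebraMap_atPrime_iff m g f).1
        (hg.dvd_iff_dvd_left.1 (hg1 _ (Ideal.mem_map_of_mem _ hf)))
    obtain ⟨s, hs, hsF⟩ := exists_notMem_forall_smul_mem (N := Ideal.span {g})
      (IsNoetherian.noetherian F) m fun f hf => by
        obtain ⟨s, hs, h⟩ := hgF f hf
        exact ⟨s, hs, Ideal.mem_span_singleton.2 h⟩
    obtain ⟨h, hh⟩ := Ideal.mem_span_singleton.1 (hsF d hdF)
    rw [smul_eq_mul] at hh
    have hs0 : s ≠ 0 := fun h0 => hs (h0 ▸ m.zero_mem)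
    -- Up to elements outside `m`, the quotient `d / g` is `h`.
    have hhJ' : h ∈ J' := by
      rw [hJ', Ideal.mem_span_singleton_colon]
      intro f hf
      obtain ⟨k, hk⟩ := Ideal.mem_span_singleton.1 (hsF f hf)
      refine ⟨k, mul_left_cancel₀ hs0 ?_⟩
      rw [smul_eq_mul] at hk
      linear_combination h * hk - k * hh
    obtain ⟨s', hs', hsJ⟩ := exists_notMem_forall_smul_mem
      (N := (Ideal.span {d}).colon {g}) (IsNoetherian.noetherian J') m fun r hr => by
        have : algebraMap R (Localization.AtPrime m) d ∣
            algebraMap R (Localization.AtPrime m) r * g' := by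
          apply hg2
          intro f hf
          rw [← Ideal.mem_span_singleton]
          have hle : F.map (algebraMap R (Localization.AtPrime m)) ≤
              (Ideal.span {algebraMap R (Localization.AtPrime m) d}).colon
                {algebraMap R (Localization.AtPrime m) r} := by
            rw [Ideal.map_le_iff_le_comap]
            intro x hx
            rw [Ideal.mem_comap, Submodule.mem_colon]
            rintro _ rfl
            rw [smul_eq_mul, Ideal.mem_span_singleton, ← map_mul, mul_comm]
            exact map_dvd _ (Ideal.mem_span_singleton_colon.1 hr x hx)
          have := Submodule.mem_colon.1 (hle hf) _ rfl
          rwa [smul_eq_mul, mul_comm] at this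
        rw [(hg.mul_left _).dvd_iff_dvd_right, ← map_mul,
          algebraMap_dvd_algebraMap_atPrime_iff] at this
        obtain ⟨t, ht, h⟩ := this
        refine ⟨t, ht, Submodule.mem_colon.2 ?_⟩
        rintro _ rfl
        rwa [smul_eq_mul, smul_eq_mul, Ideal.mem_span_singleton, mul_assoc]
    have hgJ : s' * g ∈ J := by
      rw [hJ, Ideal.mem_span_singleton_colon]
      intro r hr
      have := Submodule.mem_colon.1 (hsJ r hr) g rfl
      rw [smul_eq_mul, smul_eq_mul, Ideal.mem_span_singleton] at this
      convert this using 1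
      ring
    have hmem : s' * s ∈ (J * J').colon {d} := by
      rw [Submodule.mem_colon]
      rintro _ rfl
      have := Ideal.mul_mem_mul hgJ hhJ'
      convert this using 1
      rw [smul_eq_mul]
      linear_combination s' * hh
    exact (hm.isPrime.mem_or_mem (hle hmem)).elim hs' hs

/-- At a prime whose local ring is a discrete valuation ring, an ideal is generated by one of its
elements. -/
theorem exists_mem_forall_dvd_of_mem_dvrPrimes [IsNoetherianRing R] {Q : PrimeSpectrum R}
    (hQ : Q ∈ dvrPrimes R) (F : Ideal R) :
    ∃ f ∈ F, ∃ s ∉ Q.asIdeal, ∀ x ∈ F, f ∣ s * x := by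
  have hQ : IsDiscreteValuationRing (Localization.AtPrime Q.asIdeal) := hQ
  obtain ⟨g, hg⟩ := (IsPrincipalIdealRing.principal
    (F.map (algebraMap R (Localization.AtPrime Q.asIdeal)))).principal
  rw [Ideal.submodule_span_eq] at hg
  have hgF : g ∈ F.map (algebraMap R (Localization.AtPrime Q.asIdeal)) :=
    hg ▸ Ideal.mem_span_singleton_self g
  obtain ⟨⟨⟨f, hf⟩, s⟩, hs⟩ :=
    (IsLocalization.mem_map_algebraMap_iff Q.asIdeal.primeCompl _).1 hgF
  dsimp only at hs
  refine ⟨f, hf, ?_⟩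
  obtain ⟨t, ht, h⟩ := exists_notMem_forall_smul_mem (N := Ideal.span {f})
    (IsNoetherian.noetherian F) Q.asIdeal fun x hx => by
      have h1 : algebraMap R (Localization.AtPrime Q.asIdeal) f ∣
          algebraMap R (Localization.AtPrime Q.asIdeal) x := by
        have h2 := Ideal.mem_map_of_mem (algebraMap R (Localization.AtPrime Q.asIdeal)) hx
        rw [hg, Ideal.mem_span_singleton] at h2
        rw [← hs]
        exact (IsLocalization.map_units (Localization.AtPrime Q.asIdeal) s).mul_right_dvd.2 h2
      obtain ⟨t, ht, h⟩ := (algebraMap_dvd_algebraMap_atPrime_iff _ f x).1 h1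
      exact ⟨t, ht, Ideal.mem_span_singleton.2 h⟩
  exact ⟨t, ht, fun x hx => Ideal.mem_span_singleton.1 (h x hx)⟩

/-- An ideal and its double dual agree at the primes whose local ring is a discrete valuation
ring. -/
theorem exists_notMem_forall_mul_mem_of_mem_colon_colon [IsNoetherianRing R] {Q : PrimeSpectrum R}
    (hQ : Q ∈ dvrPrimes R) (F : Ideal R) {d : R} (hd : d ≠ 0) (hdF : d ∈ F) :
    ∃ s ∉ Q.asIdeal, ∀ j ∈ (Ideal.span {d}).colon ((Ideal.span {d}).colon (F : Set R) : Set R),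
      s * j ∈ F := by
  obtain ⟨f, hf, s, hs, h⟩ := exists_mem_forall_dvd_of_mem_dvrPrimes hQ F
  have hs0 : s ≠ 0 := fun h0 => hs (h0 ▸ Q.asIdeal.zero_mem)
  refine ⟨s, hs, fun j hj => ?_⟩
  obtain ⟨k, hk⟩ := h d hdF
  have hkJ : k ∈ (Ideal.span {d}).colon (F : Set R) := by
    rw [Ideal.mem_span_singleton_colon]
    intro x hx
    obtain ⟨l, hl⟩ := h x hx
    refine ⟨l, mul_left_cancel₀ hs0 ?_⟩
    linear_combination k * hl - l * hk
  obtain ⟨e, he⟩ := Ideal.mem_span_singleton_colon.1 hj k hkJ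
  have : s * j = e * f := mul_left_cancel₀ hd (by linear_combination j * hk + f * he)
  rw [this]
  exact F.mul_mem_left e hf

/-- An injective map `φ : M → N` whose cokernel vanishes in codimension one induces an isomorphism
of the duals: a functional on `M` extends to one on `N` with values in the fraction field, and
these values are regular at every codimension one prime. -/
theorem dualMap_bijective_of_forall_mem_dvrPrimes [IsNoetherianRing R] [IsLocallyFactorial R]
    {M N : Type*} [AddCommGroup M] [Module R M] [AddCommGroup N] [Module R N] (φ : M →ₗ[R] N)
    (hφ : Function.Injective φ) (h0 : annihilator R (N ⧸ LinearMap.range φ) ≠ ⊥)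
    (hQ : ∀ Q ∈ dvrPrimes R, ¬ annihilator R (N ⧸ LinearMap.range φ) ≤ Q.asIdeal) :
    Function.Bijective φ.dualMap := by
  have hann : ∀ r ∈ annihilator R (N ⧸ LinearMap.range φ), ∀ z, ∃ m, φ m = r • z := by
    intro r hr z
    have := mem_annihilator.1 hr (Submodule.Quotient.mk z)
    rwa [← Submodule.Quotient.mk_smul, Submodule.Quotient.mk_eq_zero] at this
  obtain ⟨d, hd, hd0⟩ := Submodule.exists_mem_ne_zero_of_ne_bot h0
  constructor
  · rw [← LinearMap.ker_eq_bot, LinearMap.ker_eq_bot']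
    intro ψ hψ
    ext z
    obtain ⟨m, hm⟩ := hann d hd z
    apply mul_left_cancel₀ hd0
    rw [← smul_eq_mul, ← map_smul, ← hm]
    have := LinearMap.congr_fun hψ m
    simpa using this
  · intro ψ
    -- The extension of `ψ` is `z ↦ ψ (d • z) / d`.
    choose θ hθ using hann d hd
    let θ' : N →ₗ[R] M :=
      { toFun := θ
        map_add' := fun x y => hφ (by rw [map_add, hθ, hθ, hθ, smul_add])
        map_smul' := fun r x => hφ (by
          rw [map_smul, hθ, hθ, smul_comm, RingHom.id_apply]) }
    obtain ⟨g, hg⟩ := exists_eq_smul_of_forall_dvd hd0 (ψ ∘ₗ θ') fun z => by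
      refine dvd_of_forall_mem_dvrPrimes hd0 fun Q hQ' => ?_
      obtain ⟨s, hs, hsQ⟩ := SetLike.not_le_iff_exists.1 (hQ Q hQ')
      obtain ⟨m, hm⟩ := hann s hs z
      refine ⟨s, hsQ, ψ m, ?_⟩
      have : s • θ z = d • m := hφ (by rw [map_smul, map_smul, hθ, hm, smul_comm])
      change s * ψ (θ z) = d * ψ m
      rw [← smul_eq_mul, ← smul_eq_mul, ← map_smul, ← map_smul, this]
    refine ⟨g, ?_⟩
    ext m
    apply mul_left_cancel₀ hd0
    rw [LinearMap.dualMap_apply, ← hg]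
    have : θ (φ m) = d • m := hφ (by rw [hθ, map_smul])
    change ψ (θ (φ m)) = _
    rw [this, map_smul, smul_eq_mul]

end DoubleDual

/-! ### Divisors of torsion modules -/

section Length

variable {R : Type u} [CommRing R]

/-- The length of the localization of a module at a prime, over the local ring at that prime. -/
noncomputable def lengthAt (Q : PrimeSpectrum R) (M : Type u) [AddCommGroup M] [Module R M] :
    ℕ∞ :=
  Module.length (Localization.AtPrime Q.asIdeal) (LocalizedModule Q.asIdeal.primeCompl M)

variable {L M N : Type u} [AddCommGroup L] [AddCommGroup M] [AddCommGroup N] [Module R L]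
  [Module R M] [Module R N]

theorem lengthAt_eq_add_of_exact (Q : PrimeSpectrum R) (f : L →ₗ[R] M) (g : M →ₗ[R] N)
    (hf : Function.Injective f) (hfg : Function.Exact f g) (hg : Function.Surjective g) :
    lengthAt Q M = lengthAt Q L + lengthAt Q N :=
  Module.length_eq_add_of_exact (LocalizedModule.map Q.asIdeal.primeCompl f)
    (LocalizedModule.map Q.asIdeal.primeCompl g)
    (LocalizedModule.map_injective Q.asIdeal.primeCompl f hf)
    (LocalizedModule.map_surjective Q.asIdeal.primeCompl g hg)
    (LocalizedModule.map_exact Q.asIdeal.primeCompl f g hfg)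

theorem lengthAt_eq_zero_iff (Q : PrimeSpectrum R) :
    lengthAt Q M = 0 ↔ ∀ x : M, ∃ s ∉ Q.asIdeal, s • x = 0 := by
  rw [lengthAt, Module.length_eq_zero_iff, LocalizedModule.subsingleton_iff]
  rfl

theorem annihilator_ne_bot_iff : annihilator R M ≠ ⊥ ↔ ∃ a : R, a ≠ 0 ∧ ∀ x : M, a • x = 0 := by
  rw [Submodule.ne_bot_iff]
  simp only [mem_annihilator]
  exact ⟨fun ⟨a, h1, h2⟩ => ⟨a, h2, h1⟩, fun ⟨a, h1, h2⟩ => ⟨a, h2, h1⟩⟩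

theorem annihilator_ne_bot_of_injective (f : L →ₗ[R] M) (hf : Function.Injective f)
    (h : annihilator R M ≠ ⊥) : annihilator R L ≠ ⊥ :=
  ne_bot_of_le_ne_bot h (f.annihilator_le_of_injective hf)

theorem annihilator_ne_bot_of_surjective (g : M →ₗ[R] N) (hg : Function.Surjective g)
    (h : annihilator R M ≠ ⊥) : annihilator R N ≠ ⊥ :=
  ne_bot_of_le_ne_bot h (g.annihilator_le_of_surjective hg)

theorem annihilator_quotient_ne_bot {I : Ideal R} (hI : I ≠ ⊥) : annihilator R (R ⧸ I) ≠ ⊥ := by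
  rwa [Ideal.annihilator_quotient]

/-- A finitely generated module killed by `I` is a quotient of a finite power of `R / I`. -/
theorem exists_surjective_of_le_annihilator {R M : Type*} [CommRing R] [AddCommGroup M] [Module R M]
    [Module.Finite R M] {I : Ideal R} (hI : I ≤ annihilator R M) :
    ∃ (n : ℕ) (g : (Fin n → R ⧸ I) →ₗ[R] M), Function.Surjective g := by
  obtain ⟨n, f, hf⟩ := Module.Finite.exists_fin' R M
  refine ⟨n, LinearMap.lsum R _ ℕ fun i =>
    I.liftQ (f ∘ₗ LinearMap.single R (fun _ : Fin n => R) i) fun a ha => ?_, fun x => ?_⟩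
  · rw [LinearMap.mem_ker, ← mul_one a, ← smul_eq_mul, map_smul]
    exact mem_annihilator.1 (hI ha) _
  · obtain ⟨y, rfl⟩ := hf x
    refine ⟨fun i => Ideal.Quotient.mk _ (y i), ?_⟩
    simp only [LinearMap.lsum_apply, LinearMap.sum_apply]
    conv_rhs => rw [← LinearMap.sum_single_apply (fun _ : Fin n => R) y, map_sum]
    rfl

theorem isFiniteLength_of_annihilator_ne_bot [IsDomain R] [IsNoetherianRing R]
    [Ring.KrullDimLE 1 R] [Module.Finite R M] (h : annihilator R M ≠ ⊥) : IsFiniteLength R M := by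
  obtain ⟨a, ha, h0⟩ := Submodule.exists_mem_ne_zero_of_ne_bot h
  have h1 := isFiniteLength_quotient_span_singleton R (mem_nonZeroDivisors_of_ne_zero h0)
  rw [isFiniteLength_iff_isNoetherian_isArtinian] at h1 ⊢
  refine ⟨inferInstance, ?_⟩
  have := h1.2
  obtain ⟨n, g, hg⟩ := exists_surjective_of_le_annihilator
    ((Ideal.span_singleton_le_iff_mem _).2 ha)
  exact isArtinian_of_surjective _ g hg

theorem lengthAt_ne_top [IsDomain R] [IsNoetherianRing R] [Module.Finite R M]
    {Q : PrimeSpectrum R} (hQ : Q ∈ dvrPrimes R) (h : annihilator R M ≠ ⊥) :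
    lengthAt Q M ≠ ⊤ := by
  have hQ : IsDiscreteValuationRing (Localization.AtPrime Q.asIdeal) := hQ
  rw [lengthAt, Module.length_ne_top_iff]
  obtain ⟨a, ha0, ha⟩ := annihilator_ne_bot_iff.1 h
  refine isFiniteLength_of_annihilator_ne_bot (annihilator_ne_bot_iff.2
    ⟨algebraMap R _ a, ?_, fun x => ?_⟩)
  · rwa [Ne, IsLocalization.to_map_eq_zero_iff _ Q.asIdeal.primeCompl_le_nonZeroDivisors]
  · induction x using LocalizedModule.induction_on with
    | h m s => rw [algebraMap_smul, LocalizedModule.smul'_mk, ha, LocalizedModule.zero_mk]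

end Length

section DivisorClass

variable {R : Type u} [CommRing R] [IsDomain R]

/-- The divisor of a torsion module: its lengths at the codimension one regular points. A point
where the length is infinite gets the coefficient zero; there is none for a finitely generated
torsion module. No finiteness of the support is recorded: divisors are arbitrary functions. -/
noncomputable def moduleDivisor (M : Type u) [AddCommGroup M] [Module R M] : dvrPrimes R → ℤ :=
  fun Q => ((lengthAt Q.1 M).toNat : ℤ)

variable {L M N : Type u} [AddCommGroup L] [AddCommGroup M] [AddCommGroup N] [Module R L]
  [Module R M] [Module R N]

theorem annihilator_ne_bot_of_exact (f : L →ₗ[R] M) (g : M →ₗ[R] N) (hfg : Function.Exact f g)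
    (hL : annihilator R L ≠ ⊥) (hN : annihilator R N ≠ ⊥) : annihilator R M ≠ ⊥ := by
  obtain ⟨a, ha0, ha⟩ := annihilator_ne_bot_iff.1 hL
  obtain ⟨b, hb0, hb⟩ := annihilator_ne_bot_iff.1 hN
  refine annihilator_ne_bot_iff.2 ⟨a * b, mul_ne_zero ha0 hb0, fun x => ?_⟩
  obtain ⟨y, hy⟩ := (hfg (b • x)).1 (by rw [map_smul, hb])
  rw [mul_smul, ← hy, ← map_smul, ha, map_zero]

theorem moduleDivisor_eq_add_of_exact [IsNoetherianRing R] [Module.Finite R M]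
    (hM : annihilator R M ≠ ⊥) (f : L →ₗ[R] M) (g : M →ₗ[R] N) (hf : Function.Injective f)
    (hfg : Function.Exact f g) (hg : Function.Surjective g) :
    moduleDivisor M = (moduleDivisor L + moduleDivisor N : dvrPrimes R → ℤ) := by
  ext Q
  have : Module.Finite R L := Module.Finite.of_injective f hf
  have : Module.Finite R N := Module.Finite.of_surjective g hg
  rw [Pi.add_apply, moduleDivisor, moduleDivisor, moduleDivisor,
    lengthAt_eq_add_of_exact Q.1 f g hf hfg hg, ENat.toNat_add
      (lengthAt_ne_top Q.2 (annihilator_ne_bot_of_injective f hf hM))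
      (lengthAt_ne_top Q.2 (annihilator_ne_bot_of_surjective g hg hM))]
  exact Nat.cast_add _ _

/-- The divisor of `R / I` is changed by the divisor of `R / a` when `I` is multiplied by `a`. -/
theorem moduleDivisor_quotient_smul [IsNoetherianRing R] {a : R} (ha : a ≠ 0) {I : Ideal R}
    (hI : I ≠ ⊥) :
    (moduleDivisor (R ⧸ a • I) : dvrPrimes R → ℤ) =
      moduleDivisor (R ⧸ I) + moduleDivisor (R ⧸ Ideal.span {a}) := by
  refine moduleDivisor_eq_add_of_exact (annihilator_quotient_ne_bot ?_)
    (Ideal.mulQuot a I) (Ideal.quotOfMul a I)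
    (Ideal.mulQuot_injective I (mem_nonZeroDivisors_of_ne_zero ha))
    (Ideal.exact_mulQuot_quotOfMul I) (Ideal.quotOfMul_surjective I)
  obtain ⟨b, hb, hb0⟩ := Submodule.exists_mem_ne_zero_of_ne_bot hI
  exact (Submodule.ne_bot_iff _).2 ⟨a * b, Submodule.smul_mem_pointwise_smul _ _ _ hb,
    mul_ne_zero ha hb0⟩

theorem Ideal.smul_span_singleton {R : Type*} [CommRing R] (a b : R) :
    a • Ideal.span {b} = Ideal.span {a * b} := by
  rw [← Ideal.submodule_span_eq, ← Ideal.submodule_span_eq, ← Submodule.singleton_set_smul,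
    Submodule.set_smul_span]
  simp

theorem moduleDivisor_span_mul [IsNoetherianRing R] {a b : R} (ha : a ≠ 0) (hb : b ≠ 0) :
    (moduleDivisor (R ⧸ Ideal.span {a * b}) : dvrPrimes R → ℤ) =
      moduleDivisor (R ⧸ Ideal.span {a}) + moduleDivisor (R ⧸ Ideal.span {b}) := by
  have := moduleDivisor_quotient_smul ha (I := Ideal.span {b}) (by simpa using hb)
  rw [Ideal.smul_span_singleton] at this
  rw [this, add_comm]

/-- The subgroup of divisors of nonzero elements of the fraction field. -/
noncomputable def principalDivisors (R : Type u) [CommRing R] [IsDomain R] [IsNoetherianRing R] :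
    AddSubgroup (dvrPrimes R → ℤ) where
  carrier := {D | ∃ a b : R, a ≠ 0 ∧ b ≠ 0 ∧
    D = moduleDivisor (R ⧸ Ideal.span {a}) - moduleDivisor (R ⧸ Ideal.span {b})}
  add_mem' := by
    rintro _ _ ⟨a, b, ha, hb, rfl⟩ ⟨c, d, hc, hd, rfl⟩
    refine ⟨a * c, b * d, mul_ne_zero ha hc, mul_ne_zero hb hd, ?_⟩
    rw [moduleDivisor_span_mul ha hc, moduleDivisor_span_mul hb hd]
    abel
  zero_mem' := ⟨1, 1, one_ne_zero, one_ne_zero, (sub_self _).symm⟩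
  neg_mem' := by
    rintro _ ⟨a, b, ha, hb, rfl⟩
    exact ⟨b, a, hb, ha, (neg_sub _ _)⟩

/-- The class of the divisor of a torsion module modulo principal divisors. -/
noncomputable def torsionClass [IsNoetherianRing R] (M : Type u) [AddCommGroup M] [Module R M] :
    (dvrPrimes R → ℤ) ⧸ principalDivisors R :=
  QuotientAddGroup.mk (moduleDivisor M)

theorem torsionClass_eq_add_of_exact [IsNoetherianRing R] [Module.Finite R M]
    (hM : annihilator R M ≠ ⊥) (f : L →ₗ[R] M) (g : M →ₗ[R] N) (hf : Function.Injective f)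
    (hfg : Function.Exact f g) (hg : Function.Surjective g) :
    torsionClass (R := R) M = torsionClass L + torsionClass N := by
  rw [torsionClass, moduleDivisor_eq_add_of_exact hM f g hf hfg hg]
  rfl

theorem torsionClass_quotient_span_singleton [IsNoetherianRing R] {a : R} (ha : a ≠ 0) :
    torsionClass (R := R) (R ⧸ Ideal.span {a}) = 0 := by
  rw [torsionClass, QuotientAddGroup.eq_zero_iff]
  refine ⟨a, 1, ha, one_ne_zero, ?_⟩
  have := moduleDivisor_span_mul (R := R) one_ne_zero one_ne_zero
  rw [mul_one] at this
  rw [left_eq_add.1 this, sub_zero]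

theorem torsionClass_eq_zero_of_subsingleton [IsNoetherianRing R] [Subsingleton M] :
    torsionClass (R := R) M = 0 := by
  have : (moduleDivisor M : dvrPrimes R → ℤ) = 0 := by
    ext Q
    rw [moduleDivisor, (lengthAt_eq_zero_iff Q.1).2 fun x =>
      ⟨1, Q.1.asIdeal.one_notMem, Subsingleton.elim _ _⟩]
    rfl
  rw [torsionClass, this]
  rfl

theorem torsionClass_eq_of_linearEquiv [IsNoetherianRing R] [Module.Finite R M]
    (hM : annihilator R M ≠ ⊥) (e : M ≃ₗ[R] N) :
    torsionClass (R := R) M = torsionClass N := by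
  rw [torsionClass_eq_add_of_exact hM (0 : PUnit.{u + 1} →ₗ[R] M) e.toLinearMap
    (Function.injective_of_subsingleton _) (by
      rw [LinearMap.exact_iff]
      simp) e.surjective, torsionClass_eq_zero_of_subsingleton, zero_add]

end DivisorClass

/-! ### The divisor class on `G₀` -/

section FullBasis

variable {R : Type u} [CommRing R] [IsDomain R]
variable {L M N : Type u} [AddCommGroup L] [AddCommGroup M] [AddCommGroup N] [Module R L]
  [Module R M] [Module R N]

/-- A linearly independent subset of a module that spans it up to torsion, that is, a basis of the
module over the fraction field which consists of elements of the module. -/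
def IsFullBasis (R : Type u) [CommRing R] {M : Type u} [AddCommGroup M] [Module R M]
    (s : Set M) : Prop :=
  LinearIndepOn R id s ∧ annihilator R (M ⧸ Submodule.span R s) ≠ ⊥

theorem annihilator_quotient_ne_bot_of_forall [Module.Finite R M] (E : Submodule R M)
    (h : ∀ x : M, ∃ a : R, a ≠ 0 ∧ a • x ∈ E) : annihilator R (M ⧸ E) ≠ ⊥ := by
  obtain ⟨a, ha, h⟩ := exists_notMem_forall_smul_mem (N := E)
    (Module.Finite.fg_top (R := R) (M := M)) ⊥ fun x _ => h x
  refine annihilator_ne_bot_iff.2 ⟨a, ha, fun x => ?_⟩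
  obtain ⟨x, rfl⟩ := Submodule.Quotient.mk_surjective _ x
  rw [← Submodule.Quotient.mk_smul, Submodule.Quotient.mk_eq_zero]
  exact h x Submodule.mem_top

theorem IsFullBasis.exists_smul_mem {R : Type u} [CommRing R] {M : Type u} [AddCommGroup M]
    [Module R M] {s : Set M} (hs : IsFullBasis R s) :
    ∃ a : R, a ≠ 0 ∧ ∀ x : M, a • x ∈ Submodule.span R s := by
  obtain ⟨a, ha, h⟩ := annihilator_ne_bot_iff.1 hs.2
  refine ⟨a, ha, fun x => ?_⟩
  rw [← Submodule.Quotient.mk_eq_zero, Submodule.Quotient.mk_smul]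
  exact h _

theorem exists_isFullBasis (R : Type u) [CommRing R] [IsDomain R] (M : Type u) [AddCommGroup M]
    [Module R M] [Module.Finite R M] :
    ∃ s : Set M, IsFullBasis R s := by
  obtain ⟨s, hs, h⟩ := exists_maximal_linearIndepOn R (id : M → M)
  refine ⟨s, hs, annihilator_quotient_ne_bot_of_forall _ fun x => ?_⟩
  by_cases hx : x ∈ s
  · exact ⟨1, one_ne_zero, by rw [one_smul]; exact Submodule.subset_span hx⟩
  · simpa using h x hx

variable [IsNoetherianRing R]

/-- Multiplying one generator by a nonzero scalar `b` changes the quotient by a copy of `R / b`,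
which has trivial class. -/
theorem torsionClass_quotient_sup_span_smul [Module.Finite R M] (E : Submodule R M) (x : M)
    (hx : ∀ r : R, r • x ∈ E → r = 0)
    (hE : annihilator R (M ⧸ E ⊔ Submodule.span R {x}) ≠ ⊥) {b : R} (hb : b ≠ 0) :
    torsionClass (R := R) (M ⧸ E ⊔ Submodule.span R {b • x}) =
      torsionClass (R := R) (M ⧸ E ⊔ Submodule.span R {x}) := by
  have hle : E ⊔ Submodule.span R {b • x} ≤ E ⊔ Submodule.span R {x} :=
    sup_le_sup_left ((Submodule.span_singleton_le_iff_mem _ _).2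
      (Submodule.smul_mem _ _ (Submodule.mem_span_singleton_self x))) _
  let f : (R ⧸ Ideal.span {b}) →ₗ[R] M ⧸ E ⊔ Submodule.span R {b • x} :=
    (Ideal.span {b}).liftQ ((Submodule.mkQ _) ∘ₗ LinearMap.toSpanSingleton R M x) (by
      rw [Ideal.span_le, Set.singleton_subset_iff, SetLike.mem_coe, LinearMap.mem_ker,
        LinearMap.comp_apply, LinearMap.toSpanSingleton_apply, Submodule.mkQ_apply,
        Submodule.Quotient.mk_eq_zero]
      exact Submodule.mem_sup_right (Submodule.mem_span_singleton_self _))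
  let g : (M ⧸ E ⊔ Submodule.span R {b • x}) →ₗ[R] M ⧸ E ⊔ Submodule.span R {x} :=
    Submodule.factor hle
  have hf : Function.Injective f := by
    rw [← LinearMap.ker_eq_bot, LinearMap.ker_eq_bot']
    intro r hr
    obtain ⟨r, rfl⟩ := Ideal.Quotient.mk_surjective r
    have hr : (Submodule.mkQ (E ⊔ Submodule.span R {b • x})) (r • x) = 0 := hr
    rw [Submodule.mkQ_apply, Submodule.Quotient.mk_eq_zero, Submodule.mem_sup] at hr
    obtain ⟨e, he, y, hy, h⟩ := hr
    obtain ⟨c, rfl⟩ := Submodule.mem_span_singleton.1 hy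
    have : r - c * b = 0 := hx _ (by
      rw [sub_smul, ← h, mul_smul, add_sub_cancel_right]; exact he)
    rw [Ideal.Quotient.eq_zero_iff_mem, Ideal.mem_span_singleton]
    exact ⟨c, by rw [mul_comm]; exact sub_eq_zero.1 this⟩
  have hg : Function.Surjective g := Submodule.factor_surjective hle
  have hfg : Function.Exact f g := by
    intro y
    constructor
    · intro hy
      obtain ⟨y, rfl⟩ := Submodule.Quotient.mk_surjective _ y
      have hy : (Submodule.Quotient.mk y : M ⧸ E ⊔ Submodule.span R {x}) = 0 := hy
      rw [Submodule.Quotient.mk_eq_zero, Submodule.mem_sup] at hy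
      obtain ⟨e, he, z, hz, rfl⟩ := hy
      obtain ⟨c, rfl⟩ := Submodule.mem_span_singleton.1 hz
      refine ⟨Ideal.Quotient.mk _ c, ?_⟩
      change Submodule.Quotient.mk (c • x) = _
      rw [eq_comm, Submodule.Quotient.eq, add_sub_cancel_right]
      exact Submodule.mem_sup_left he
    · rintro ⟨r, rfl⟩
      obtain ⟨r, rfl⟩ := Ideal.Quotient.mk_surjective r
      change (Submodule.Quotient.mk (r • x) : M ⧸ E ⊔ Submodule.span R {x}) = 0
      rw [Submodule.Quotient.mk_eq_zero]
      exact Submodule.mem_sup_right (Submodule.smul_mem _ _ (Submodule.mem_span_singleton_self x))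
  rw [torsionClass_eq_add_of_exact (annihilator_ne_bot_of_exact f g hfg
    (annihilator_quotient_ne_bot (by simpa using hb)) hE) f g hf hfg hg,
    torsionClass_quotient_span_singleton hb, zero_add]

theorem IsFullBasis.finite [Module.Finite R M] {s : Set M} (hs : IsFullBasis R s) : s.Finite :=
  LinearIndependent.set_finite_of_isNoetherian (R := R) hs.1

/-- Exchange: an element `x` of a full basis `s` can be replaced by an element `y` of a full basis
`t`. The class of the quotient does not change, as `a • y` and `b • x` agree modulo the span of the
other elements of `s`, for some nonzero scalars `a` and `b`. -/
theorem IsFullBasis.exists_exchange [Module.Finite R M] {s t : Set M} (hs : IsFullBasis R s)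
    (ht : IsFullBasis R t) {x : M} (hx : x ∈ s) : ∃ y ∈ t, IsFullBasis R (insert y (s \ {x})) ∧
      torsionClass (R := R) (M ⧸ Submodule.span R (insert y (s \ {x}))) =
        torsionClass (R := R) (M ⧸ Submodule.span R s) := by
  have hxE : ∀ r : R, r • x ∈ Submodule.span R (s \ {x}) → r = 0 := fun r hr =>
    hs.1.eq_zero_of_smul_mem_span hx r (by simpa using hr)
  have hspan : Submodule.span R s = Submodule.span R (s \ {x}) ⊔ Submodule.span R {x} := by
    rw [← Submodule.span_union, Set.sdiff_union_self, Set.union_eq_self_of_subset_right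
      (Set.singleton_subset_iff.2 hx)]
  -- If all of `t` were torsion modulo the span of `s \ {x}`, then so would be `x`.
  obtain ⟨y, hyt, hy⟩ : ∃ y ∈ t, ∀ r : R, r • y ∈ Submodule.span R (s \ {x}) → r = 0 := by
    by_contra! h
    obtain ⟨a, ha0, ha⟩ := ht.exists_smul_mem
    have key : ∀ z ∈ Submodule.span R t, ∃ b ∉ (⊥ : Ideal R),
        b • z ∈ Submodule.span R (s \ {x}) := by
      intro z hz
      induction hz using Submodule.span_induction with
      | mem z hz =>
        obtain ⟨r, hr, hr0⟩ := h z hz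
        exact ⟨r, hr0, hr⟩
      | zero => exact ⟨1, one_ne_zero, by rw [smul_zero]; exact Submodule.zero_mem _⟩
      | add z w _ _ hz hw =>
        obtain ⟨b, hb, hz⟩ := hz
        obtain ⟨c, hc, hw⟩ := hw
        refine ⟨b * c, mul_ne_zero hb hc, ?_⟩
        rw [smul_add]
        refine Submodule.add_mem _ ?_ ?_
        · rw [mul_comm, mul_smul]
          exact Submodule.smul_mem _ _ hz
        · rw [mul_smul]
          exact Submodule.smul_mem _ _ hw
      | smul c z _ hz =>
        obtain ⟨b, hb, hz⟩ := hz
        exact ⟨b, hb, by rw [smul_comm]; exact Submodule.smul_mem _ _ hz⟩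
    obtain ⟨b, hb, hbx⟩ := key _ (ha x)
    rw [smul_smul] at hbx
    exact mul_ne_zero hb ha0 (hxE _ hbx)
  obtain ⟨a, ha0, ha⟩ := hs.exists_smul_mem
  have hay := ha y
  rw [hspan, Submodule.mem_sup] at hay
  obtain ⟨e, he, z, hz, hez⟩ := hay
  obtain ⟨b, rfl⟩ := Submodule.mem_span_singleton.1 hz
  have hb0 : b ≠ 0 := by
    rintro rfl
    rw [zero_smul, add_zero] at hez
    exact ha0 (hy a (hez ▸ he))
  have hsup : Submodule.span R (s \ {x}) ⊔ Submodule.span R {a • y} =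
      Submodule.span R (s \ {x}) ⊔ Submodule.span R {b • x} := by
    have hmem : ∀ {E : Submodule R M} {v w e : M}, e ∈ E → v = w + e →
        E ⊔ Submodule.span R {v} ≤ E ⊔ Submodule.span R {w} := by
      intro E v w e he h
      refine sup_le le_sup_left ((Submodule.span_singleton_le_iff_mem _ _).2 ?_)
      rw [h, add_comm]
      exact Submodule.add_mem_sup he (Submodule.mem_span_singleton_self w)
    apply le_antisymm
    · exact hmem he (by rw [← hez, add_comm])
    · exact hmem (neg_mem he) (by rw [← hez]; abel)
  have hspan' : Submodule.span R (insert y (s \ {x})) =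
      Submodule.span R (s \ {x}) ⊔ Submodule.span R {y} := by
    rw [Submodule.span_insert, sup_comm]
  have hann : annihilator R (M ⧸ Submodule.span R (s \ {x}) ⊔ Submodule.span R {y}) ≠ ⊥ := by
    refine annihilator_quotient_ne_bot_of_forall _ fun z => ⟨b * a, mul_ne_zero hb0 ha0, ?_⟩
    have hz := ha z
    rw [hspan, Submodule.mem_sup] at hz
    obtain ⟨e', he', w, hw, h⟩ := hz
    obtain ⟨c, rfl⟩ := Submodule.mem_span_singleton.1 hw
    rw [mul_smul, ← h, smul_add, smul_comm]
    refine Submodule.add_mem _ (Submodule.mem_sup_left (Submodule.smul_mem _ _ he')) ?_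
    refine Submodule.smul_mem _ _ ?_
    have : b • x = a • y - e := by rw [← hez, add_sub_cancel_left]
    rw [this]
    exact Submodule.sub_mem _ (Submodule.mem_sup_right
      (Submodule.smul_mem _ _ (Submodule.mem_span_singleton_self y))) (Submodule.mem_sup_left he)
  refine ⟨y, hyt,
    ⟨(hs.1.mono Set.sdiff_subset).id_insert' hy, hspan' ▸ hann⟩, ?_⟩
  have h1 := torsionClass_quotient_sup_span_smul _ x hxE (hspan ▸ hs.2) hb0
  have h2 := torsionClass_quotient_sup_span_smul _ y hy hann ha0
  rw [hspan', hspan, ← h1, ← h2, hsup]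

/-- The class of the quotient of a module by the span of a full basis is independent of the full
basis: full bases are connected by exchanges of single elements. -/
theorem IsFullBasis.torsionClass_eq [Module.Finite R M] {s t : Set M} (hs : IsFullBasis R s)
    (ht : IsFullBasis R t) :
    torsionClass (R := R) (M ⧸ Submodule.span R s) =
      torsionClass (R := R) (M ⧸ Submodule.span R t) := by
  induction hn : (s \ t).ncard generalizing s with
  | zero =>
    have hst : s ⊆ t := by
      rwa [Set.ncard_eq_zero (hs.finite.subset Set.sdiff_subset), Set.sdiff_eq_empty] at hn
    suffices s = t by rw [this]
    refine hst.antisymm fun y hy => ?_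
    by_contra hys
    obtain ⟨a, ha0, ha⟩ := hs.exists_smul_mem
    refine ha0 (ht.1.eq_zero_of_smul_mem_span hy a (Submodule.span_mono ?_ (ha y)))
    simpa using Set.subset_sdiff_singleton hst hys
  | succ n ih =>
    obtain ⟨x, hx⟩ : (s \ t).Nonempty := Set.nonempty_of_ncard_ne_zero (by omega)
    obtain ⟨y, hyt, hfull, heq⟩ := hs.exists_exchange ht hx.1
    rw [← heq]
    refine ih hfull ?_
    have : insert y (s \ {x}) \ t = (s \ t) \ {x} := by
      ext z
      simp only [Set.mem_sdiff, Set.mem_insert_iff, Set.mem_singleton_iff]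
      constructor
      · rintro ⟨rfl | ⟨h1, h2⟩, h3⟩
        · exact absurd hyt h3
        · exact ⟨⟨h1, h3⟩, h2⟩
      · rintro ⟨⟨h1, h3⟩, h2⟩
        exact ⟨Or.inr ⟨h1, h2⟩, h3⟩
    rw [this, Set.ncard_sdiff_singleton_of_mem hx, hn]
    rfl

/-- The divisor class of a finitely generated module (its first Chern class): the divisor of its
quotient by the span of a full basis, modulo principal divisors. -/
noncomputable def divisorClass (R : Type u) [CommRing R] [IsDomain R] [IsNoetherianRing R]
    (M : Type u) [AddCommGroup M] [Module R M] [Module.Finite R M] :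
    (dvrPrimes R → ℤ) ⧸ principalDivisors R :=
  torsionClass (R := R) (M ⧸ Submodule.span R (exists_isFullBasis R M).choose)

theorem divisorClass_eq [Module.Finite R M] {s : Set M} (hs : IsFullBasis R s) :
    divisorClass R M = torsionClass (R := R) (M ⧸ Submodule.span R s) :=
  (exists_isFullBasis R M).choose_spec.torsionClass_eq hs

theorem divisorClass_eq_torsionClass [Module.Finite R M] (h : annihilator R M ≠ ⊥) :
    divisorClass R M = torsionClass (R := R) M := by
  have e : (M ⧸ Submodule.span R (∅ : Set M)) ≃ₗ[R] M :=
    Submodule.quotEquivOfEqBot _ Submodule.span_empty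
  have h' : annihilator R (M ⧸ Submodule.span R (∅ : Set M)) ≠ ⊥ :=
    annihilator_ne_bot_of_injective e.toLinearMap e.injective h
  rw [divisorClass_eq (s := ∅) ⟨linearIndepOn_empty R _, h'⟩, torsionClass_eq_of_linearEquiv h' e]

theorem divisorClass_self : divisorClass R R = 0 := by
  have h : Submodule.span R {(1 : R)} = ⊤ := Ideal.span_singleton_one
  have : Subsingleton (R ⧸ Submodule.span R {(1 : R)}) :=
    Submodule.Quotient.subsingleton_iff.2 h
  rw [divisorClass_eq (s := {1}) ⟨LinearIndepOn.singleton one_ne_zero,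
    annihilator_ne_bot_iff.2 ⟨1, one_ne_zero, fun _ => Subsingleton.elim _ _⟩⟩,
    torsionClass_eq_zero_of_subsingleton]

/-- The divisor class is additive on short exact sequences: a full basis of `L` and a lift of a full
basis of `N` form a full basis of `M`. -/
theorem divisorClass_eq_add_of_exact [Module.Finite R L] [Module.Finite R M] [Module.Finite R N]
    (f : L →ₗ[R] M) (g : M →ₗ[R] N) (hf : Function.Injective f) (hfg : Function.Exact f g)
    (hg : Function.Surjective g) : divisorClass R M = divisorClass R L + divisorClass R N := by
  obtain ⟨s, hs⟩ := exists_isFullBasis R L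
  obtain ⟨t, ht⟩ := exists_isFullBasis R N
  choose σ hσ using hg
  have hgσ : g '' (σ '' t) = t := by
    rw [Set.image_image]
    simp [hσ]
  -- The relations of `N` lift, so that nothing in the span of `σ '' t` comes from `L`.
  have hker : ∀ z ∈ Submodule.span R (σ '' t), g z = 0 → z = 0 := by
    have hli : LinearIndepOn R (g ∘ σ) t := by
      have : g ∘ σ = id := funext hσ
      rw [this]
      exact ht.1
    have := LinearIndepOn.of_comp g hli
    intro z hz hgz
    rw [Finsupp.mem_span_image_iff_linearCombination] at hz
    obtain ⟨l, hl, rfl⟩ := hz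
    rw [Finsupp.apply_linearCombination] at hgz
    rw [linearIndepOn_iff.1 hli l hl hgz, map_zero]
  let E := Submodule.span R s
  let D := Submodule.span R t
  let B := Submodule.span R (f '' s ∪ σ '' t)
  have hB : B = E.map f ⊔ Submodule.span R (σ '' t) := by
    rw [Submodule.map_span, ← Submodule.span_union]
  have hEB : E ≤ B.comap f := by
    rw [← Submodule.map_le_iff_le_comap, hB]
    exact le_sup_left
  have hBD : B ≤ D.comap g := by
    rw [hB, sup_le_iff]
    constructor
    · rw [Submodule.map_le_iff_le_comap]
      intro z _
      rw [Submodule.mem_comap, Submodule.mem_comap, hfg.apply_apply_eq_zero]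
      exact Submodule.zero_mem _
    · rw [← Submodule.map_le_iff_le_comap, Submodule.map_span, hgσ]
  have hmemE : ∀ z, f z ∈ B → z ∈ E := by
    intro z hz
    rw [hB, Submodule.mem_sup] at hz
    obtain ⟨_, ⟨e, he, rfl⟩, w, hw, h⟩ := hz
    have hw0 : w = 0 := hker w hw (by
      have := congrArg g h
      rwa [map_add, hfg.apply_apply_eq_zero, hfg.apply_apply_eq_zero, zero_add] at this)
    rw [hw0, add_zero] at h
    exact hf h ▸ he
  let f' : (L ⧸ E) →ₗ[R] M ⧸ B := Submodule.mapQ E B f hEB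
  let g' : (M ⧸ B) →ₗ[R] N ⧸ D := Submodule.mapQ B D g hBD
  have hf' : Function.Injective f' := by
    rw [← LinearMap.ker_eq_bot, LinearMap.ker_eq_bot']
    intro z hz
    obtain ⟨z, rfl⟩ := Submodule.Quotient.mk_surjective _ z
    rw [Submodule.mapQ_apply, Submodule.Quotient.mk_eq_zero] at hz
    rw [Submodule.Quotient.mk_eq_zero]
    exact hmemE z hz
  have hg' : Function.Surjective g' := by
    intro z
    obtain ⟨z, rfl⟩ := Submodule.Quotient.mk_surjective _ z
    exact ⟨Submodule.Quotient.mk (σ z), by rw [Submodule.mapQ_apply, hσ]⟩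
  have hfg' : Function.Exact f' g' := by
    intro z
    constructor
    · intro hz
      obtain ⟨z, rfl⟩ := Submodule.Quotient.mk_surjective _ z
      rw [Submodule.mapQ_apply, Submodule.Quotient.mk_eq_zero] at hz
      have hD : D = (Submodule.span R (σ '' t)).map g := by rw [Submodule.map_span, hgσ]
      rw [hD] at hz
      obtain ⟨w, hw, h⟩ := hz
      obtain ⟨l, hl⟩ := (hfg (z - w)).1 (by rw [map_sub, h, sub_self])
      refine ⟨Submodule.Quotient.mk l, ?_⟩
      rw [Submodule.mapQ_apply, hl, eq_comm, Submodule.Quotient.eq, sub_sub_cancel, hB]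
      exact Submodule.mem_sup_right hw
    · rintro ⟨z, rfl⟩
      obtain ⟨z, rfl⟩ := Submodule.Quotient.mk_surjective _ z
      rw [Submodule.mapQ_apply, Submodule.mapQ_apply, hfg.apply_apply_eq_zero,
        Submodule.Quotient.mk_zero]
  have hann : annihilator R (M ⧸ B) ≠ ⊥ := annihilator_ne_bot_of_exact f' g' hfg' hs.2 ht.2
  have hfull : IsFullBasis R (f '' s ∪ σ '' t) := by
    refine ⟨LinearIndepOn.id_union ?_ ?_ ?_, hann⟩
    · exact (hs.1.map_injOn f hf.injOn).id_image
    · refine LinearIndepOn.id_image (LinearIndepOn.of_comp g ?_)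
      have : g ∘ σ = id := funext hσ
      rw [this]
      exact ht.1
    · rw [Submodule.disjoint_def]
      intro z hz1 hz2
      rw [← Submodule.map_span] at hz1
      obtain ⟨w, -, rfl⟩ := hz1
      exact hker _ hz2 (hfg.apply_apply_eq_zero _)
  rw [divisorClass_eq hs, divisorClass_eq ht, divisorClass_eq hfull]
  exact torsionClass_eq_add_of_exact hann f' g' hf' hfg' hg'

/-- The divisor class as a homomorphism on `G₀`. -/
noncomputable def G0.divisorClass (R : Type u) [CommRing R] [IsDomain R] [IsNoetherianRing R] :
    G0 R →+ (dvrPrimes R → ℤ) ⧸ principalDivisors R :=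
  QuotientAddGroup.lift _ (FreeAbelianGroup.lift fun
    M : {M : ModuleCat.{u} R // Module.Finite R M} =>
    haveI := M.2
    _root_.divisorClass R M.1) <| by
      rw [AddSubgroup.closure_le]
      rintro _ ⟨M, N, L, f, g, hf, hfg, hg, rfl⟩
      have := M.2
      have := N.2
      have := L.2
      rw [SetLike.mem_coe, AddMonoidHom.mem_ker, map_sub, map_add, FreeAbelianGroup.lift_apply_of,
        FreeAbelianGroup.lift_apply_of, FreeAbelianGroup.lift_apply_of,
        divisorClass_eq_add_of_exact f g hf hfg hg, sub_self]

theorem G0.divisorClass_mk [Module.Finite R M] :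
    G0.divisorClass R (G0.mk R M) = _root_.divisorClass R M :=
  FreeAbelianGroup.lift_apply_of _ _

end FullBasis

/-! ### Relations in `G₀` and `K₀` -/

section GrothendieckGroup

theorem ModuleGrothendieckGroup.mk_eq_add_of_exact {R : Type u} [CommRing R]
    {P : ModuleCat.{u} R → Prop} {L M N : ModuleCat.{u} R} (hL : P L) (hM : P M) (hN : P N)
    (f : L →ₗ[R] M) (g : M →ₗ[R] N) (hf : Function.Injective f) (hfg : Function.Exact f g)
    (hg : Function.Surjective g) :
    ModuleGrothendieckGroup.mk R P M hM =
      ModuleGrothendieckGroup.mk R P L hL + ModuleGrothendieckGroup.mk R P N hN := by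
  rw [← sub_eq_zero]
  exact (QuotientAddGroup.eq_zero_iff _).2 (AddSubgroup.subset_closure
    ⟨⟨L, hL⟩, ⟨M, hM⟩, ⟨N, hN⟩, f, g, hf, hfg, hg, rfl⟩)

variable {R : Type u} [CommRing R] {L M N : Type u} [AddCommGroup L] [AddCommGroup M]
  [AddCommGroup N] [Module R L] [Module R M] [Module R N]

theorem G0.mk_eq_add_of_exact [Module.Finite R L] [Module.Finite R M] [Module.Finite R N]
    (f : L →ₗ[R] M) (g : M →ₗ[R] N) (hf : Function.Injective f) (hfg : Function.Exact f g)
    (hg : Function.Surjective g) : G0.mk R M = G0.mk R L + G0.mk R N :=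
  ModuleGrothendieckGroup.mk_eq_add_of_exact (L := .of R L) (M := .of R M) (N := .of R N)
    ‹_› ‹_› ‹_› f g hf hfg hg

theorem G0.mk_eq_zero_of_subsingleton [Module.Finite R M] [Subsingleton M] : G0.mk R M = 0 := by
  have := G0.mk_eq_add_of_exact (LinearMap.id : M →ₗ[R] M) (LinearMap.id : M →ₗ[R] M)
    Function.injective_id (fun x => ⟨fun _ => ⟨x, rfl⟩, fun _ => Subsingleton.elim _ _⟩)
    Function.surjective_id
  exact left_eq_add.1 this

theorem G0.mk_eq_of_linearEquiv [Module.Finite R M] [Module.Finite R N] (e : M ≃ₗ[R] N) :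
    G0.mk R M = G0.mk R N := by
  rw [G0.mk_eq_add_of_exact (0 : PUnit.{u + 1} →ₗ[R] M) e.toLinearMap
    (Function.injective_of_subsingleton _) (by rw [LinearMap.exact_iff]; simp) e.surjective,
    G0.mk_eq_zero_of_subsingleton, zero_add]

theorem K0.mk_eq_of_linearEquiv [Module.Finite R M] [Module.Finite R N] [Projective R M]
    [Projective R N] (e : M ≃ₗ[R] N) : K0.mk R M = K0.mk R N := by
  have key : ∀ (L : Type u) [AddCommGroup L] [Module R L] [Module.Finite R L] [Projective R L]
      (f : L →ₗ[R] M) (g : M →ₗ[R] N), Function.Injective f → Function.Exact f g →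
      Function.Surjective g → K0.mk R M = K0.mk R L + K0.mk R N := by
    intro L _ _ hL1 hL2 f g hf hfg hg
    exact ModuleGrothendieckGroup.mk_eq_add_of_exact (L := .of R L) (M := .of R M) (N := .of R N)
      ⟨hL1, hL2⟩ ⟨‹_›, ‹_›⟩ ⟨‹_›, ‹_›⟩ f g hf hfg hg
  have h0 : K0.mk R PUnit.{u + 1} = 0 := by
    have := ModuleGrothendieckGroup.mk_eq_add_of_exact
      (P := fun M : ModuleCat.{u} R => Module.Finite R M ∧ Projective R M)
      (L := .of R PUnit.{u + 1}) (M := .of R PUnit.{u + 1}) (N := .of R PUnit.{u + 1})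
      ⟨inferInstance, inferInstance⟩ ⟨inferInstance, inferInstance⟩ ⟨inferInstance, inferInstance⟩
      LinearMap.id LinearMap.id
      Function.injective_id (fun x => ⟨fun _ => ⟨x, rfl⟩, fun _ => Subsingleton.elim _ _⟩)
      Function.surjective_id
    exact left_eq_add.1 this
  rw [key PUnit.{u + 1} 0 e.toLinearMap
    (Function.injective_of_subsingleton _) (by rw [LinearMap.exact_iff]; simp) e.surjective,
    h0, zero_add]

/-- The Cartan homomorphism, which forgets that a module is projective. -/
noncomputable def K0.toG0 (R : Type u) [CommRing R] : K0 R →+ G0 R :=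
  QuotientAddGroup.lift _ (FreeAbelianGroup.lift
    fun M : {M : ModuleCat.{u} R // Module.Finite R M ∧ Projective R M} =>
      ModuleGrothendieckGroup.mk R (fun M => Module.Finite R M) M.1 M.2.1) <| by
    rw [AddSubgroup.closure_le]
    rintro _ ⟨M, N, L, f, g, hf, hfg, hg, rfl⟩
    rw [SetLike.mem_coe, AddMonoidHom.mem_ker, map_sub, map_add, FreeAbelianGroup.lift_apply_of,
      FreeAbelianGroup.lift_apply_of, FreeAbelianGroup.lift_apply_of,
      ModuleGrothendieckGroup.mk_eq_add_of_exact M.2.1 N.2.1 L.2.1 f g hf hfg hg, sub_self]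

theorem K0.toG0_mk [Module.Finite R M] [Projective R M] : K0.toG0 R (K0.mk R M) = G0.mk R M :=
  FreeAbelianGroup.lift_apply_of _ _

/-- If the residue fields of a Noetherian ring have trivial class in `G₀`, then so has every
finitely generated module that is supported at maximal ideals. -/
theorem G0.mk_eq_zero_of_isMaximal [IsNoetherianRing R]
    (hres : ∀ m : Ideal R, m.IsMaximal → G0.mk R (R ⧸ m) = 0) [hM : Module.Finite R M]
    (h : ∀ P : Ideal R, P.IsPrime → annihilator R M ≤ P → P.IsMaximal) : G0.mk R M = 0 := by
  induction hM using IsNoetherianRing.induction_on_isQuotientEquivQuotientPrime R with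
  | subsingleton N => exact G0.mk_eq_zero_of_subsingleton
  | quotient N p e =>
    rw [G0.mk_eq_of_linearEquiv e]
    exact hres _ (h _ p.2 (by rw [e.annihilator_eq, Ideal.annihilator_quotient]))
  | exact N₁ N₂ N₃ f g hf hg hfg h₁ h₃ =>
    rw [G0.mk_eq_add_of_exact f g hf hfg hg,
      h₁ fun P hP hle => h P hP ((f.annihilator_le_of_injective hf).trans hle),
      h₃ fun P hP hle => h P hP ((g.annihilator_le_of_surjective hg).trans hle), zero_add]

end GrothendieckGroup

/-! ### Invertible ideals are determined by their class in `G₀` -/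

section InvertibleIdeals

variable {R : Type u} [CommRing R] [IsDomain R] [IsNoetherianRing R]

/-- An inclusion of an ideal in an invertible ideal can be checked at the codimension one regular
points. -/
theorem Ideal.le_of_forall_mem_dvrPrimes [IsLocallyFactorial R] {J₁ J₂ J' : Ideal R} {d : R}
    (hd : d ≠ 0) (hJ : J₂ * J' = Ideal.span {d})
    (h : ∀ Q ∈ dvrPrimes R, ∃ s ∉ Q.asIdeal, ∀ x ∈ J₁, s * x ∈ J₂) : J₁ ≤ J₂ := by
  intro a ha
  have hdvd : ∀ y ∈ J', d ∣ a * y := fun y hy => by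
    refine dvd_of_forall_mem_dvrPrimes hd fun Q hQ => ?_
    obtain ⟨s, hs, h⟩ := h Q hQ
    refine ⟨s, hs, ?_⟩
    rw [← Ideal.mem_span_singleton, ← hJ, ← mul_assoc]
    exact Ideal.mul_mem_mul (h a ha) hy
  have hmem : ∀ x ∈ J₂ * J', a * x ∈ J₂ * Ideal.span {d} := by
    intro x hx
    induction hx using Submodule.mul_induction_on' with
    | mem_mul_mem x hx y hy =>
      rw [mul_left_comm]
      exact Ideal.mul_mem_mul hx (Ideal.mem_span_singleton.2 (hdvd y hy))
    | add x _ y _ hx hy =>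
      rw [mul_add]
      exact Ideal.add_mem _ hx hy
  obtain ⟨z, hz, h⟩ := Ideal.mem_mul_span_singleton.1
    (hmem d (hJ ▸ Ideal.mem_span_singleton_self d))
  exact mul_right_cancel₀ hd h ▸ hz

omit [IsDomain R] [IsNoetherianRing R] in
theorem lengthAt_quotient_eq_of_forall_dvd (Q : PrimeSpectrum R) {J : Ideal R} {f s : R}
    (hf : f ∈ J) (hs : s ∉ Q.asIdeal) (h : ∀ x ∈ J, f ∣ s * x) :
    lengthAt Q (R ⧸ J) = lengthAt Q (R ⧸ Ideal.span {f}) := by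
  have hle : Ideal.span {f} ≤ J := (Ideal.span_singleton_le_iff_mem _).2 hf
  let g : (R ⧸ Ideal.span {f}) →ₗ[R] R ⧸ J := Submodule.factor hle
  rw [lengthAt_eq_add_of_exact Q (LinearMap.ker g).subtype g (Submodule.subtype_injective _)
    (LinearMap.exact_subtype_ker_map g) (Submodule.factor_surjective hle),
    (lengthAt_eq_zero_iff (M := LinearMap.ker g) Q).2, zero_add]
  rintro ⟨x, hx⟩
  obtain ⟨x, rfl⟩ := Ideal.Quotient.mk_surjective x
  have hx : Ideal.Quotient.mk J x = 0 := hx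
  rw [Ideal.Quotient.eq_zero_iff_mem] at hx
  refine ⟨s, hs, Subtype.ext ?_⟩
  change Ideal.Quotient.mk _ (s * x) = 0
  rw [Ideal.Quotient.eq_zero_iff_mem, Ideal.mem_span_singleton]
  exact h x hx

/-- In a discrete valuation ring, ideals of the same colength coincide. -/
theorem exists_notMem_forall_mul_mem_of_moduleDivisor_eq {J₁ J₂ : Ideal R} (h₁ : J₁ ≠ ⊥)
    (h₂ : J₂ ≠ ⊥)
    (h : (moduleDivisor (R ⧸ J₁) : dvrPrimes R → ℤ) = moduleDivisor (R ⧸ J₂))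
    {Q : PrimeSpectrum R} (hQ : Q ∈ dvrPrimes R) :
    ∃ s ∉ Q.asIdeal, ∀ x ∈ J₁, s * x ∈ J₂ := by
  have hlen : lengthAt Q (R ⧸ J₁) = lengthAt Q (R ⧸ J₂) := by
    have h3 := congrFun h ⟨Q, hQ⟩
    rw [moduleDivisor, moduleDivisor, Nat.cast_inj] at h3
    rw [← ENat.natCast_toNat (lengthAt_ne_top hQ (annihilator_quotient_ne_bot h₁)),
      ← ENat.natCast_toNat (lengthAt_ne_top hQ (annihilator_quotient_ne_bot h₂))]
    exact congrArg Nat.cast h3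
  obtain ⟨f₁, hf₁, s₁, hs₁, hd₁⟩ := exists_mem_forall_dvd_of_mem_dvrPrimes hQ J₁
  obtain ⟨f₂, hf₂, s₂, hs₂, hd₂⟩ := exists_mem_forall_dvd_of_mem_dvrPrimes hQ J₂
  have hne : ∀ {s : R}, s ∉ Q.asIdeal → s ≠ 0 := fun hs h0 => hs (h0 ▸ Q.asIdeal.zero_mem)
  have hne₁ : f₁ ≠ 0 := by
    rintro rfl
    obtain ⟨b, hb, hb0⟩ := Submodule.exists_mem_ne_zero_of_ne_bot h₁
    exact mul_ne_zero (hne hs₁) hb0 (zero_dvd_iff.1 (hd₁ b hb))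
  have hQ' : IsDiscreteValuationRing (Localization.AtPrime Q.asIdeal) := hQ
  rcases ValuationRing.dvd_total (algebraMap R (Localization.AtPrime Q.asIdeal) f₁)
    (algebraMap R (Localization.AtPrime Q.asIdeal) f₂) with hdvd | hdvd
  · obtain ⟨s, hs, k, hk⟩ := (algebraMap_dvd_algebraMap_atPrime_iff _ _ _).1 hdvd
    have hne₂ : f₂ ≠ 0 := by
      rintro rfl
      obtain ⟨b, hb, hb0⟩ := Submodule.exists_mem_ne_zero_of_ne_bot h₂
      exact mul_ne_zero (hne hs₂) hb0 (zero_dvd_iff.1 (hd₂ b hb))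
    have hk0 : k ≠ 0 := by
      rintro rfl
      rw [mul_zero] at hk
      exact mul_ne_zero (hne hs) hne₂ hk
    -- `f₂ ∼ f₁ k` at `Q`, and the lengths of `R / f₁` and `R / f₂` agree, so `k` is a unit at `Q`.
    have e := congrFun (moduleDivisor_span_mul hne₁ hk0) ⟨Q, hQ⟩
    rw [← hk, moduleDivisor_span_mul (hne hs) hne₂, Pi.add_apply, Pi.add_apply] at e
    simp only [moduleDivisor] at e
    rw [← lengthAt_quotient_eq_of_forall_dvd Q hf₁ hs₁ hd₁,
      ← lengthAt_quotient_eq_of_forall_dvd Q hf₂ hs₂ hd₂, hlen,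
      (lengthAt_eq_zero_iff (M := R ⧸ Ideal.span {s}) Q).2] at e
    · have e0 : (lengthAt Q (R ⧸ Ideal.span {k})).toNat = 0 := by
        simpa using e
      rw [ENat.toNat_eq_zero, or_iff_left (lengthAt_ne_top hQ
        (annihilator_quotient_ne_bot (by simpa using hk0))), lengthAt_eq_zero_iff] at e0
      obtain ⟨t, ht, hmem⟩ := e0 1
      have hmem : Ideal.Quotient.mk (Ideal.span {k}) (t * 1) = 0 := hmem
      rw [mul_one, Ideal.Quotient.eq_zero_iff_mem, Ideal.mem_span_singleton] at hmem
      have hkQ : k ∉ Q.asIdeal := fun hkQ => ht (Ideal.mem_of_dvd _ hmem hkQ)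
      refine ⟨k * s₁, fun hmem => (Q.isPrime.mem_or_mem hmem).elim hkQ hs₁, fun x hx => ?_⟩
      obtain ⟨l, hl⟩ := hd₁ x hx
      have : k * s₁ * x = s * l * f₂ := by linear_combination k * hl - l * hk
      rw [this]
      exact J₂.mul_mem_left _ hf₂
    · intro x
      obtain ⟨x, rfl⟩ := Ideal.Quotient.mk_surjective x
      refine ⟨s, hs, ?_⟩
      change Ideal.Quotient.mk _ (s * x) = 0
      rw [Ideal.Quotient.eq_zero_iff_mem, Ideal.mem_span_singleton]
      exact dvd_mul_right _ _
  · obtain ⟨s, hs, k, hk⟩ := (algebraMap_dvd_algebraMap_atPrime_iff _ _ _).1 hdvd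
    refine ⟨s * s₁, fun hmem => (Q.isPrime.mem_or_mem hmem).elim hs hs₁, fun x hx => ?_⟩
    obtain ⟨l, hl⟩ := hd₁ x hx
    have : s * s₁ * x = k * l * f₂ := by linear_combination s * hl + l * hk
    rw [this]
    exact J₂.mul_mem_left _ hf₂

omit [IsNoetherianRing R] in
theorem Ideal.smul_ne_bot {a : R} (ha : a ≠ 0) {J : Ideal R} (hJ : J ≠ ⊥) : a • J ≠ ⊥ := by
  obtain ⟨b, hb, hb0⟩ := Submodule.exists_mem_ne_zero_of_ne_bot hJ
  exact (Submodule.ne_bot_iff _).2 ⟨a * b, Submodule.smul_mem_pointwise_smul _ _ _ hb,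
    mul_ne_zero ha hb0⟩

omit [IsNoetherianRing R] in
theorem Ideal.nonempty_linearEquiv_smul {a : R} (ha : a ≠ 0) (J : Ideal R) :
    Nonempty (J ≃ₗ[R] (a • J : Ideal R)) :=
  ⟨Submodule.equivMapOfInjective (DistribSMul.toLinearMap R R a) (mul_right_injective₀ ha) J⟩

/-- Invertible ideals of a locally factorial Noetherian domain with the same class in `G₀` are
isomorphic: their divisors differ by a principal divisor, so that `a • J₁` and `b • J₂` have the
same divisor for some nonzero `a` and `b`, and are therefore equal. -/
theorem Ideal.nonempty_linearEquiv_of_G0_mk_eq [IsLocallyFactorial R] {J₁ J₂ J₁' J₂' : Ideal R}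
    {d₁ d₂ : R} (hd₁ : d₁ ≠ 0) (hd₂ : d₂ ≠ 0) (h₁ : J₁ * J₁' = Ideal.span {d₁})
    (h₂ : J₂ * J₂' = Ideal.span {d₂}) (h : G0.mk R J₁ = G0.mk R J₂) : Nonempty (J₁ ≃ₗ[R] J₂) := by
  have hne : ∀ {J J' : Ideal R} {d : R}, d ≠ 0 → J * J' = Ideal.span {d} → J ≠ ⊥ := by
    rintro J J' d hd h rfl
    rw [Ideal.bot_mul, eq_comm, Ideal.span_singleton_eq_bot] at h
    exact hd h
  have hJ₁ := hne hd₁ h₁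
  have hJ₂ := hne hd₂ h₂
  have hcl : ∀ J : Ideal R, J ≠ ⊥ → torsionClass (R := R) (R ⧸ J) = - divisorClass R J := by
    intro J hJ
    have h1 : divisorClass R (R ⧸ J) = torsionClass (R := R) (R ⧸ J) :=
      divisorClass_eq_torsionClass (annihilator_quotient_ne_bot hJ)
    have h2 : divisorClass R R = divisorClass R J + divisorClass R (R ⧸ J) :=
      divisorClass_eq_add_of_exact J.subtype J.mkQ J.subtype_injective
        (LinearMap.exact_subtype_mkQ J) J.mkQ_surjective
    rw [divisorClass_self, h1] at h2
    exact eq_neg_of_add_eq_zero_right h2.symm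
  have hdc : divisorClass R J₁ = divisorClass R J₂ := by
    rw [← G0.divisorClass_mk, h, G0.divisorClass_mk]
  have htc : torsionClass (R := R) (R ⧸ J₁) = torsionClass (R := R) (R ⧸ J₂) := by
    rw [hcl _ hJ₁, hcl _ hJ₂, hdc]
  obtain ⟨a, b, ha, hb, hab⟩ := QuotientAddGroup.eq.1 htc
  have hdiv : (moduleDivisor (R ⧸ a • J₁) : dvrPrimes R → ℤ) = moduleDivisor (R ⧸ b • J₂) := by
    rw [moduleDivisor_quotient_smul ha hJ₁, moduleDivisor_quotient_smul hb hJ₂]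
    linear_combination -hab
  have hinv : ∀ {c d : R} {J J' : Ideal R}, J * J' = Ideal.span {d} →
      (c • J) * J' = Ideal.span {c * d} := fun h => by
    rw [smul_mul_assoc, h, Ideal.smul_span_singleton]
  have heq : a • J₁ = b • J₂ := le_antisymm
    (Ideal.le_of_forall_mem_dvrPrimes (mul_ne_zero hb hd₂) (hinv h₂) fun Q hQ =>
      exists_notMem_forall_mul_mem_of_moduleDivisor_eq (Ideal.smul_ne_bot ha hJ₁)
        (Ideal.smul_ne_bot hb hJ₂) hdiv hQ)
    (Ideal.le_of_forall_mem_dvrPrimes (mul_ne_zero ha hd₁) (hinv h₁) fun Q hQ =>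
      exists_notMem_forall_mul_mem_of_moduleDivisor_eq (Ideal.smul_ne_bot hb hJ₂)
        (Ideal.smul_ne_bot ha hJ₁) hdiv.symm hQ)
  obtain ⟨e₁⟩ := Ideal.nonempty_linearEquiv_smul ha J₁
  obtain ⟨e₂⟩ := Ideal.nonempty_linearEquiv_smul hb J₂
  exact ⟨e₁ ≪≫ₗ LinearEquiv.ofEq _ _ heq ≪≫ₗ e₂.symm⟩

end InvertibleIdeals

/-! ### Finite-dimensional modules -/

section FiniteDimensional

variable {R : Type u} [CommRing R] [Algebra ℂ R]

/-- A finitely generated module over a finitely generated algebra that is supported at maximal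
ideals is finite-dimensional. -/
theorem finite_complex_of_isMaximal [Algebra.FiniteType ℂ R] {M : Type*} [AddCommGroup M]
    [Module R M] [Module ℂ M] [IsScalarTower ℂ R M] [Module.Finite R M]
    (h : ∀ P : Ideal R, P.IsPrime → annihilator R M ≤ P → P.IsMaximal) : Module.Finite ℂ M := by
  have : IsNoetherianRing R := Algebra.FiniteType.isNoetherianRing ℂ R
  have : IsArtinianRing (R ⧸ annihilator R M) := by
    rw [isArtinianRing_iff_isNoetherianRing_krullDimLE_zero]
    refine ⟨inferInstance, Ring.KrullDimLE.mk₀ fun I hI => ?_⟩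
    have hc := h (I.comap (Ideal.Quotient.mk _)) inferInstance fun x hx => by
      rw [Ideal.mem_comap, Ideal.Quotient.eq_zero_iff_mem.2 hx]
      exact I.zero_mem
    have := Ideal.map_eq_top_or_isMaximal_of_surjective (Ideal.Quotient.mk (annihilator R M))
      Ideal.Quotient.mk_surjective hc
    rw [Ideal.map_comap_of_surjective _ Ideal.Quotient.mk_surjective] at this
    exact this.resolve_left hI.ne_top
  have hfin : Module.Finite ℂ (R ⧸ annihilator R M) := Module.finite_of_isArtinianRing _ _
  obtain ⟨n, g, hg⟩ := exists_surjective_of_le_annihilator (le_refl (annihilator R M))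
  exact Module.Finite.of_surjective (g.restrictScalars ℂ) hg

/-- The annihilator of a finite-dimensional module has finite codimension, so that all primes
containing it are maximal. -/
theorem isMaximal_of_annihilator_le {M : Type*} [AddCommGroup M] [Module R M] [Module ℂ M]
    [IsScalarTower ℂ R M] [Module.Finite ℂ M] (P : Ideal R) [P.IsPrime]
    (h : annihilator R M ≤ P) : P.IsMaximal := by
  let ψ : R →ₐ[ℂ] End ℂ M := Algebra.lsmul ℂ ℂ M
  have hker : RingHom.ker ψ ≤ P := fun r hr => h (mem_annihilator.2 fun x => by
    have := LinearMap.congr_fun ((RingHom.mem_ker).1 hr) x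
    simpa [ψ] using this)
  have : Module.Finite ℂ (R ⧸ RingHom.ker ψ) :=
    Module.Finite.of_injective (Ideal.kerLiftAlg ψ).toLinearMap (Ideal.kerLiftAlg_injective ψ)
  have : Module.Finite ℂ (R ⧸ P) :=
    Module.Finite.of_surjective (Ideal.Quotient.factorₐ ℂ hker).toLinearMap
      (Ideal.Quotient.factor_surjective hker)
  have hf : IsField (R ⧸ P) := isField_of_isIntegral_of_isField' (Field.toIsField ℂ)
  exact Ideal.Quotient.maximal_of_isField P hf

end FiniteDimensional

/-! ### Ideals on locally factorial surfaces -/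

section Surface

variable {R : Type u} [CommRing R] [IsDomain R]

theorem isMaximal_of_forall_mem_dvrPrimes [IsNoetherianRing R] [IsLocallyFactorial R]
    (hht : ∀ m : Ideal R, m.IsMaximal → m.height = 2) {𝔞 : Ideal R} (h0 : 𝔞 ≠ ⊥)
    (h : ∀ Q ∈ dvrPrimes R, ¬ 𝔞 ≤ Q.asIdeal) (P : Ideal R) (hP : P.IsPrime) (hle : 𝔞 ≤ P) :
    P.IsMaximal := by
  by_contra hmax
  exact h ⟨P, hP⟩ (mem_dvrPrimes_of_not_isMaximal hht ⟨P, hP⟩ (ne_bot_of_le_ne_bot h0 hle) hmax)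
    hle

theorem ne_bot_of_forall_isMaximal (hht : ∀ m : Ideal R, m.IsMaximal → m.height = 2)
    {𝔞 : Ideal R} (h : ∀ P : Ideal R, P.IsPrime → 𝔞 ≤ P → P.IsMaximal) : 𝔞 ≠ ⊥ := by
  rintro rfl
  have h1 := hht ⊥ (h ⊥ Ideal.isPrime_bot le_rfl)
  rw [Ideal.height_bot] at h1
  exact absurd h1 (by decide)

theorem not_le_of_forall_isMaximal (hht : ∀ m : Ideal R, m.IsMaximal → m.height = 2)
    {𝔞 : Ideal R} (h : ∀ P : Ideal R, P.IsPrime → 𝔞 ≤ P → P.IsMaximal) :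
    ∀ Q ∈ dvrPrimes R, ¬ 𝔞 ≤ Q.asIdeal := by
  intro Q hQ hle
  have h1 := hht _ (h _ Q.isPrime hle)
  rw [height_eq_one_of_mem_dvrPrimes hQ] at h1
  exact absurd h1 (by decide)

/-- The comparison of an ideal with an invertible ideal on a locally factorial affine surface whose
points have trivial class in `G₀`. -/
theorem tfae_of_isLocallyFactorial [Algebra ℂ R] [Algebra.FiniteType ℂ R] [IsLocallyFactorial R]
    (hht : ∀ m : Ideal R, m.IsMaximal → m.height = 2)
    (hres : ∀ m : Ideal R, m.IsMaximal → G0.mk R (R ⧸ m) = 0)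
    (F : Ideal R) (hF : F ≠ ⊥) (J J' : Ideal R) {c : R} (hc : c ≠ 0)
    (hJ : J * J' = Ideal.span {c}) :
    ∃ (_ : Module.Finite R F) (_ : Module.Invertible R (Dual R (Dual R F)))
      (_ : Module.Invertible R J),
      List.TFAE [
        G0.mk R F = G0.mk R J,
        K0.mk R (Dual R (Dual R F)) = K0.mk R J,
        CommRing.Pic.mk R (Dual R (Dual R F)) = CommRing.Pic.mk R J,
        ∃ φ : F →ₗ[R] J, Function.Injective φ ∧ Module.Finite ℂ (J ⧸ LinearMap.range φ)] := by
  have : IsNoetherianRing R := Algebra.FiniteType.isNoetherianRing ℂ R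
  obtain ⟨d, hdF, hd⟩ := Submodule.exists_mem_ne_zero_of_ne_bot hF
  -- The ideal `E` is the double dual of `F`; its inverse is `F'`, up to the factor `d`.
  let F' := (Ideal.span {d}).colon (F : Set R)
  let E := (Ideal.span {d}).colon (F' : Set R)
  have hE : E * F' = Ideal.span {d} := F.colon_colon_mul_colon hd hdF
  have e : Dual R (Dual R F) ≃ₗ[R] E := F.doubleDualEquiv hd hdF
  have hFE : F ≤ E := F.le_span_singleton_colon_colon d
  have hinvE : Module.Invertible R E := Ideal.invertible_of_mul_eq_span_singleton hd hE
  have hinvF : Module.Invertible R (Dual R (Dual R F)) := .congr e.symm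
  have hinvJ : Module.Invertible R J := Ideal.invertible_of_mul_eq_span_singleton hc hJ
  refine ⟨inferInstance, hinvF, hinvJ, ?_⟩
  -- The cokernel of `F → E ≃ N` is supported at maximal ideals.
  have hsupp : ∀ {N : Type u} [AddCommGroup N] [Module R N] (i : E ≃ₗ[R] N) (P : Ideal R),
      P.IsPrime →
      annihilator R (N ⧸ LinearMap.range (i.toLinearMap ∘ₗ Submodule.inclusion hFE)) ≤ P →
      P.IsMaximal := by
    intro N _ _ i
    have hmem : ∀ s : R, (∀ j ∈ E, s * j ∈ F) →
        s ∈ annihilator R (N ⧸ LinearMap.range (i.toLinearMap ∘ₗ Submodule.inclusion hFE)) := by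
      intro s hs
      rw [mem_annihilator]
      intro x
      obtain ⟨x, rfl⟩ := Submodule.Quotient.mk_surjective _ x
      rw [← Submodule.Quotient.mk_smul, Submodule.Quotient.mk_eq_zero]
      refine ⟨⟨s * (i.symm x : R), hs _ (i.symm x).2⟩, ?_⟩
      have : Submodule.inclusion hFE ⟨s * (i.symm x : R), hs _ (i.symm x).2⟩ = s • i.symm x := rfl
      rw [LinearMap.comp_apply, this, map_smul, LinearEquiv.coe_coe, i.apply_symm_apply]
    refine isMaximal_of_forall_mem_dvrPrimes hht ?_ fun Q hQ hle => ?_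
    · exact (Submodule.ne_bot_iff _).2 ⟨d, hmem d fun j _ => F.mul_mem_right j hdF, hd⟩
    · obtain ⟨s, hs, h⟩ := exists_notMem_forall_mul_mem_of_mem_colon_colon hQ F hd hdF
      exact hs (hle (hmem s h))
  have hinj : ∀ {N : Type u} [AddCommGroup N] [Module R N] (i : E ≃ₗ[R] N),
      Function.Injective (i.toLinearMap ∘ₗ Submodule.inclusion hFE) := fun i =>
    i.injective.comp (Submodule.inclusion_injective hFE)
  have hG : G0.mk R F = G0.mk R E := by
    let φ := (LinearEquiv.refl R E).toLinearMap ∘ₗ Submodule.inclusion hFE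
    have h0 : G0.mk R (E ⧸ LinearMap.range φ) = 0 :=
      G0.mk_eq_zero_of_isMaximal hres (hsupp (LinearEquiv.refl R E))
    rw [G0.mk_eq_add_of_exact φ (LinearMap.range φ).mkQ (hinj (LinearEquiv.refl R E))
      (LinearMap.exact_map_mkQ_range φ) (Submodule.mkQ_surjective _), h0, add_zero]
  have hGK : G0.mk R E = G0.mk R J → Nonempty (E ≃ₗ[R] J) :=
    Ideal.nonempty_linearEquiv_of_G0_mk_eq hd hc hE hJ
  tfae_have 1 → 3 := fun h => by
    obtain ⟨i⟩ := hGK (hG ▸ h)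
    exact CommRing.Pic.mk_eq_mk_iff.2 ⟨e ≪≫ₗ i⟩
  tfae_have 2 → 3 := fun h => by
    have h := congrArg (K0.toG0 R) h
    rw [K0.toG0_mk, K0.toG0_mk, G0.mk_eq_of_linearEquiv e] at h
    obtain ⟨i⟩ := hGK h
    exact CommRing.Pic.mk_eq_mk_iff.2 ⟨e ≪≫ₗ i⟩
  tfae_have 3 → 1 := fun h => by
    obtain ⟨i⟩ := CommRing.Pic.mk_eq_mk_iff.1 h
    rw [hG, ← G0.mk_eq_of_linearEquiv e, G0.mk_eq_of_linearEquiv i]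
  tfae_have 3 → 2 := fun h => by
    obtain ⟨i⟩ := CommRing.Pic.mk_eq_mk_iff.1 h
    exact K0.mk_eq_of_linearEquiv i
  tfae_have 3 → 4 := fun h => by
    obtain ⟨i⟩ := CommRing.Pic.mk_eq_mk_iff.1 h
    exact ⟨(e.symm ≪≫ₗ i).toLinearMap ∘ₗ Submodule.inclusion hFE, hinj _,
      finite_complex_of_isMaximal (hsupp _)⟩
  tfae_have 4 → 3 := by
    rintro ⟨φ, hφ, hfin⟩
    have hmax : ∀ P : Ideal R, P.IsPrime → annihilator R (J ⧸ LinearMap.range φ) ≤ P →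
        P.IsMaximal := fun P hP hle => isMaximal_of_annihilator_le P hle
    have hbij := dualMap_bijective_of_forall_mem_dvrPrimes φ hφ
      (ne_bot_of_forall_isMaximal hht hmax) (not_le_of_forall_isMaximal hht hmax)
    -- The cokernel of `φ` is invisible in codimension one, so `φ` becomes bijective on duals.
    let ε : Dual R J ≃ₗ[R] Dual R F := LinearEquiv.ofBijective _ hbij
    exact CommRing.Pic.mk_eq_mk_iff.2 ⟨ε.dualMap ≪≫ₗ (evalEquiv R J).symm⟩
  tfae_finish

end Surface

/-! ### Symmetric algebras of invertible modules -/

section SymmetricAlgebra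

open TensorProduct Polynomial

namespace SymmetricAlgebra

/-- If the base change of `D` to `B` is free of rank one, then the base change of the symmetric
algebra of `D` is a polynomial ring in one variable. -/
noncomputable def baseChangeEquivPolynomial {A B D : Type*} [CommRing A] [CommRing B] [Algebra A B]
    [AddCommGroup D] [Module A D] (e : B ⊗[A] D ≃ₗ[B] B) :
    B ⊗[A] SymmetricAlgebra A D ≃ₐ[B] B[X] :=
  let f : SymmetricAlgebra A D →ₐ[A] B[X] := lift
    ((monomial 1).restrictScalars A ∘ₗ e.toLinearMap.restrictScalars A ∘ₗ TensorProduct.mk A B D 1)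
  have hf (d : D) : f (ι A D d) = monomial 1 (e (1 ⊗ₜ d)) := lift_ι_apply _ d
  have hX (z : B ⊗[A] D) : Algebra.TensorProduct.lift (Algebra.ofId B B[X]) f
      (fun _ _ => Commute.all _ _) ((ι A D).baseChange B z) = monomial 1 (e z) := by
    induction z with
    | zero => simp
    | add x y hx hy => simp only [map_add, hx, hy]
    | tmul b d =>
      have hb : b ⊗ₜ[A] d = b • (1 ⊗ₜ[A] d) := by
        rw [TensorProduct.smul_tmul', smul_eq_mul, mul_one]
      rw [LinearMap.baseChange_tmul, Algebra.TensorProduct.lift_tmul, hf, hb, map_smul,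
        smul_eq_mul, Algebra.ofId_apply, ← C_eq_algebraMap, C_mul_monomial]
  AlgEquiv.ofAlgHom
    (Algebra.TensorProduct.lift (Algebra.ofId B B[X]) f fun _ _ => Commute.all _ _)
    (aeval ((ι A D).baseChange B (e.symm 1)))
    (by
      ext
      rw [AlgHom.comp_apply, aeval_X, hX, e.apply_symm_apply]
      rfl)
    (by
      apply Algebra.TensorProduct.ext_ring
      apply algHom_ext
      ext d
      -- The class of `d` is the multiple `e (1 ⊗ d)` of the generator `e.symm 1`.
      have h : (e (1 ⊗ₜ[A] d) : B) • e.symm 1 = 1 ⊗ₜ[A] d := by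
        rw [← map_smul, smul_eq_mul, mul_one, e.symm_apply_apply]
      change aeval ((ι A D).baseChange B (e.symm 1)) (Algebra.TensorProduct.lift
        (Algebra.ofId B B[X]) f (fun _ _ => Commute.all _ _) (1 ⊗ₜ ι A D d)) = 1 ⊗ₜ ι A D d
      rw [Algebra.TensorProduct.lift_tmul, map_one (Algebra.ofId B B[X]), one_mul, hf,
        aeval_monomial, pow_one,
        ← Algebra.smul_def, ← map_smul, h, LinearMap.baseChange_tmul])

variable {A : Type*} [CommRing A] {D : Type*} [AddCommGroup D] [Module A D]

/-- The symmetric algebra of a projective module is a retract of that of a free module. -/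
instance [IsDomain A] [Module.Projective A D] : IsDomain (SymmetricAlgebra A D) := by
  obtain ⟨s, hs⟩ := Module.Projective.out (R := A) (P := D)
  let i : SymmetricAlgebra A D →ₐ[A] SymmetricAlgebra A (D →₀ A) := lift (ι A _ ∘ₗ s)
  let p : SymmetricAlgebra A (D →₀ A) →ₐ[A] SymmetricAlgebra A D :=
    lift (ι A _ ∘ₗ Finsupp.linearCombination A id)
  have h : p.comp i = AlgHom.id A _ := by
    apply algHom_ext
    ext d
    simp [i, p, hs d]
  have hinj : Function.Injective i := fun x y hxy => by
    rw [← AlgHom.id_apply (R := A) x, ← AlgHom.id_apply (R := A) y, ← h, AlgHom.comp_apply, hxy,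
      AlgHom.comp_apply]
  exact hinj.isDomain i.toRingHom

instance [Module.Finite A D] : Algebra.FiniteType A (SymmetricAlgebra A D) := by
  obtain ⟨n, f, hf⟩ := Module.Finite.exists_fin' A D
  have : Algebra.FiniteType A (SymmetricAlgebra A (Fin n → A)) :=
    .equiv inferInstance (equivMvPolynomial (Pi.basisFun A (Fin n))).symm
  refine .of_surjective (lift (ι A D ∘ₗ f) : SymmetricAlgebra A (Fin n → A) →ₐ[A] _) fun x => ?_
  induction x using SymmetricAlgebra.induction with
  | algebraMap r => exact ⟨algebraMap A _ r, AlgHom.commutes _ r⟩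
  | ι d =>
    obtain ⟨v, rfl⟩ := hf d
    exact ⟨ι A _ v, lift_ι_apply _ v⟩
  | mul a b ha hb =>
    obtain ⟨a, rfl⟩ := ha
    obtain ⟨b, rfl⟩ := hb
    exact ⟨a * b, map_mul _ _ _⟩
  | add a b ha hb =>
    obtain ⟨a, rfl⟩ := ha
    obtain ⟨b, rfl⟩ := hb
    exact ⟨a + b, map_add _ _ _⟩

variable (A D) in
theorem nonempty_tensor_ringEquiv_polynomial [Module.Invertible A D] (B : Type*) [CommRing B]
    [IsLocalRing B] [Algebra A B] : Nonempty (SymmetricAlgebra A D ⊗[A] B ≃+* B[X]) := by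
  obtain ⟨e⟩ := Module.Invertible.free_iff_linearEquiv.1 (inferInstance : Free B (B ⊗[A] D))
  exact ⟨(Algebra.TensorProduct.comm A _ B).toRingEquiv.trans
    (baseChangeEquivPolynomial e).toRingEquiv⟩

theorem nonempty_quotient_ringEquiv_polynomial [Module.Invertible A D] (p : Ideal A)
    [p.IsMaximal] : Nonempty (SymmetricAlgebra A D ⧸
      p.map (algebraMap A (SymmetricAlgebra A D)) ≃+* (A ⧸ p)[X]) := by
  let := Ideal.Quotient.field p
  obtain ⟨e⟩ := nonempty_tensor_ringEquiv_polynomial A D (A ⧸ p)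
  exact ⟨(Algebra.TensorProduct.quotIdealMapEquivTensorQuot _ p).toRingEquiv.trans e⟩

end SymmetricAlgebra

/-- The contraction of a maximal ideal along a finitely generated algebra over a Jacobson ring is
maximal. -/
theorem Ideal.IsMaximal.under_of_finiteType {A R : Type*} [CommRing A] [CommRing R] [Algebra A R]
    [IsJacobsonRing A] [Algebra.FiniteType A R] (m : Ideal R) [m.IsMaximal] :
    (m.under A).IsMaximal := by
  let := Ideal.Quotient.field m
  have : Module.Finite A (R ⧸ m) := finite_of_finite_type_of_isJacobsonRing A (R ⧸ m)
  have h := Ideal.isMaximal_comap_of_isIntegral_of_isMaximal (R := A) (⊥ : Ideal (R ⧸ m))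
  convert h
  rw [IsScalarTower.algebraMap_eq A R (R ⧸ m), ← Ideal.comap_comap, ← RingHom.ker_eq_comap_bot,
    Ideal.Quotient.algebraMap_eq, Ideal.mk_ker]

/-- If the point `m` is a principal divisor in the integral subscheme cut out by `P`, then its
residue field has trivial class. -/
theorem G0.mk_quotient_eq_zero_of_isPrincipalIdealRing {R : Type u} [CommRing R] {P m : Ideal R}
    [P.IsPrime] [IsPrincipalIdealRing (R ⧸ P)] (h : P < m) : G0.mk R (R ⧸ m) = 0 := by
  obtain ⟨g, hg⟩ := (IsPrincipalIdealRing.principal (m.map (Ideal.Quotient.mk P))).principal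
  have hg0 : g ≠ 0 := by
    rintro rfl
    rw [Submodule.span_zero_singleton, Ideal.map_eq_bot_iff_le_ker, Ideal.mk_ker] at hg
    exact h.not_ge hg
  have hmul : Function.Injective (LinearMap.mulLeft R g) := fun x y hxy => mul_left_cancel₀ hg0 hxy
  have hex : Function.Exact (LinearMap.mulLeft R g) (Submodule.factor h.le) := fun x => by
    obtain ⟨x, rfl⟩ := Ideal.Quotient.mk_surjective x
    have h1 : Submodule.factor h.le (Ideal.Quotient.mk P x) = 0 ↔ x ∈ m :=
      Submodule.Quotient.mk_eq_zero m
    have h2 : x ∈ m ↔ Ideal.Quotient.mk P x ∈ m.map (Ideal.Quotient.mk P) := by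
      rw [← Ideal.mem_comap, Ideal.comap_map_of_surjective' _ Ideal.Quotient.mk_surjective,
        Ideal.mk_ker, sup_eq_left.2 h.le]
    rw [h1, h2, hg, Ideal.submodule_span_eq, Ideal.mem_span_singleton']
    exact exists_congr fun y => by rw [LinearMap.mulLeft_apply, mul_comm]
  exact left_eq_add.1 (G0.mk_eq_add_of_exact _ _ hmul hex (Submodule.factor_surjective h.le))

theorem Ideal.algebraMapSubmonoid_primeCompl_under_le {A R : Type*} [CommRing A] [CommRing R]
    [Algebra A R] (m : Ideal R) [m.IsPrime] :
    Algebra.algebraMapSubmonoid R (m.under A).primeCompl ≤ m.primeCompl := by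
  rintro _ ⟨a, ha, rfl⟩
  exact ha

section

variable {A D : Type*} [CommRing A] [AddCommGroup D] [Module A D] [Module.Invertible A D]

/-- The fibre of a line bundle over a closed point is integral. -/
theorem SymmetricAlgebra.isPrime_map (p : Ideal A) [p.IsMaximal] :
    (p.map (algebraMap A (SymmetricAlgebra A D))).IsPrime := by
  let := Ideal.Quotient.field p
  obtain ⟨e⟩ := nonempty_quotient_ringEquiv_polynomial (D := D) p
  exact (Ideal.Quotient.isDomain_iff_prime _).1 e.toMulEquiv.isDomain

/-- A closed point of a line bundle is not dense in the fibre through it. -/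
theorem SymmetricAlgebra.map_under_lt [IsJacobsonRing A] (m : Ideal (SymmetricAlgebra A D))
    [m.IsMaximal] : (m.under A).map (algebraMap A (SymmetricAlgebra A D)) < m := by
  have hp : (m.under A).IsMaximal := Ideal.IsMaximal.under_of_finiteType m
  let := Ideal.Quotient.field (m.under A)
  obtain ⟨e⟩ := nonempty_quotient_ringEquiv_polynomial (D := D) (m.under A)
  refine lt_of_le_of_ne Ideal.map_comap_le fun h => ?_
  have := (Ideal.Quotient.maximal_ideal_iff_isField_quotient _).1 (h ▸ ‹m.IsMaximal›)
  exact Polynomial.not_isField _ (e.symm.toMulEquiv.isField this)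

end

section Dedekind

variable (A D : Type u) [CommRing A] [IsDedekindDomain A] [AddCommGroup D] [Module A D]
  [Module.Invertible A D]

theorem SymmetricAlgebra.ufm_tensor_atPrime (p : Ideal A) [p.IsMaximal] (hA : ¬ IsField A) :
    UniqueFactorizationMonoid (SymmetricAlgebra A D ⊗[A] Localization.AtPrime p) := by
  have := IsLocalization.AtPrime.isDiscreteValuationRing_of_dedekind_domain A
    (Ring.ne_bot_of_isMaximal_of_not_isField ‹_› hA) (Localization.AtPrime p)
  obtain ⟨e⟩ := nonempty_tensor_ringEquiv_polynomial A D (Localization.AtPrime p)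
  exact e.symm.toMulEquiv.uniqueFactorizationMonoid inferInstance

theorem SymmetricAlgebra.ringKrullDim_tensor_atPrime (p : Ideal A) [p.IsMaximal]
    (hA : ¬ IsField A) : ringKrullDim (SymmetricAlgebra A D ⊗[A] Localization.AtPrime p) = 2 := by
  have := IsLocalization.AtPrime.isDiscreteValuationRing_of_dedekind_domain A
    (Ring.ne_bot_of_isMaximal_of_not_isField ‹_› hA) (Localization.AtPrime p)
  obtain ⟨e⟩ := nonempty_tensor_ringEquiv_polynomial A D (Localization.AtPrime p)
  rw [ringKrullDim_eq_of_ringEquiv e, Polynomial.ringKrullDim_of_isNoetherianRing,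
    IsDiscreteValuationRing.ringKrullDim_eq_one]
  rfl

variable {A D} [IsJacobsonRing A]

/-- Locally over the curve, a line bundle over it is an affine line over a discrete valuation
ring. -/
theorem SymmetricAlgebra.isLocallyFactorial (hA : ¬ IsField A) :
    IsLocallyFactorial (SymmetricAlgebra A D) where
  ufm m hm := by
    have hp : (m.under A).IsMaximal := Ideal.IsMaximal.under_of_finiteType m
    have := SymmetricAlgebra.ufm_tensor_atPrime A D (m.under A) hA
    let T := SymmetricAlgebra A D ⊗[A] Localization.AtPrime (m.under A)
    let N := Algebra.algebraMapSubmonoid (SymmetricAlgebra A D) (m.under A).primeCompl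
    have hN : N ≤ m.primeCompl := Ideal.algebraMapSubmonoid_primeCompl_under_le m
    let := IsLocalization.localizationAlgebraOfSubmonoidLe T (Localization.AtPrime m) N
      m.primeCompl hN
    have := IsLocalization.localization_isScalarTower_of_submonoid_le T (Localization.AtPrime m) N
      m.primeCompl hN
    have := IsLocalization.isLocalization_of_submonoid_le T (Localization.AtPrime m) N
      m.primeCompl hN
    exact UniqueFactorizationMonoid.of_isLocalization (M := T)
      (m.primeCompl.map (algebraMap (SymmetricAlgebra A D) T)) _

/-- The upper bound is the dimension of the affine line over the local ring of the curve, the lower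
bound comes from the fibre through the point. -/
theorem SymmetricAlgebra.height_of_isMaximal (hA : ¬ IsField A)
    (m : Ideal (SymmetricAlgebra A D)) [m.IsMaximal] : m.height = 2 := by
  have hp : (m.under A).IsMaximal := Ideal.IsMaximal.under_of_finiteType m
  have hp0 := Ring.ne_bot_of_isMaximal_of_not_isField hp hA
  have hN := Ideal.algebraMapSubmonoid_primeCompl_under_le (A := A) m
  apply le_antisymm
  · let T := SymmetricAlgebra A D ⊗[A] Localization.AtPrime (m.under A)
    have hdis : Disjoint (Algebra.algebraMapSubmonoid (SymmetricAlgebra A D)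
        (m.under A).primeCompl : Set (SymmetricAlgebra A D)) m :=
      Set.disjoint_left.2 fun x hx => hN hx
    have := IsLocalization.isPrime_of_isPrime_disjoint _ T m inferInstance hdis
    have h := Ideal.height_le_ringKrullDim_of_ne_top this.ne_top
    rw [IsLocalization.height_map_of_disjoint _ m hdis,
      SymmetricAlgebra.ringKrullDim_tensor_atPrime A D (m.under A) hA] at h
    exact WithBot.coe_le_coe.1 h
  · have hP := SymmetricAlgebra.isPrime_map (D := D) (m.under A)
    have hP0 : ⊥ < (m.under A).map (algebraMap A (SymmetricAlgebra A D)) :=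
      bot_lt_iff_ne_bot.2 <| by
        rwa [Ne, Ideal.map_eq_bot_iff_of_injective
          (SymmetricAlgebra.algebraMap_leftInverse D).injective]
    have hPm := SymmetricAlgebra.map_under_lt m
    have h1 := Ideal.height_add_one_le_of_lt_of_isPrime hP0
    have h2 := Ideal.height_add_one_le_of_lt_of_isPrime hPm
    rw [Ideal.height_bot, zero_add] at h1
    exact (add_le_add_left h1 1).trans h2

end Dedekind

/-- The residue field at a point of a line bundle over a curve has trivial class: the point is a
principal divisor in the fibre through it, which is an affine line. -/
theorem SymmetricAlgebra.G0_mk_quotient_eq_zero {A D : Type u} [CommRing A] [AddCommGroup D]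
    [Module A D] [Module.Invertible A D] [IsJacobsonRing A] (m : Ideal (SymmetricAlgebra A D))
    [m.IsMaximal] : G0.mk (SymmetricAlgebra A D) (SymmetricAlgebra A D ⧸ m) = 0 := by
  have hp : (m.under A).IsMaximal := Ideal.IsMaximal.under_of_finiteType m
  let := Ideal.Quotient.field (m.under A)
  obtain ⟨e⟩ := nonempty_quotient_ringEquiv_polynomial (D := D) (m.under A)
  have := SymmetricAlgebra.isPrime_map (D := D) (m.under A)
  have := IsPrincipalIdealRing.of_surjective e.symm.toRingHom e.symm.surjective
  exact G0.mk_quotient_eq_zero_of_isPrincipalIdealRing (SymmetricAlgebra.map_under_lt m)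

end SymmetricAlgebra

/-! ### Differentials on smooth affine curves -/

section RankOne

open TensorProduct

/-- A finitely generated projective module of rank one over a Dedekind domain is invertible: a
nonzero linear form identifies it with an ideal. -/
theorem Module.Invertible.of_finrank_eq_one {A : Type*} {M : Type*} [CommRing A]
    [IsDedekindDomain A] [AddCommGroup M] [Module A M] [Module.Finite A M]
    [Projective A M]
    (h : finrank A M = 1) : Module.Invertible A M := by
  have : Nontrivial M := nontrivial_of_finrank_pos (R := A) (by omega)
  obtain ⟨x, hx⟩ := exists_ne (0 : M)
  obtain ⟨f, hf⟩ := Projective.exists_dual_ne_zero A hx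
  have hinj : Function.Injective f := by
    -- An element `y` of the kernel satisfies a linear relation with `x`, which `f` forces to be
    -- `b • y = 0`.
    rw [← LinearMap.ker_eq_bot, Submodule.eq_bot_iff]
    intro y hy
    rw [LinearMap.mem_ker] at hy
    by_contra hy0
    obtain ⟨a, b, hab, hne⟩ : ∃ a b : A, a • x + b • y = 0 ∧ ¬(a = 0 ∧ b = 0) := by
      by_contra! hcon
      have hli : LinearIndependent A ![x, y] := LinearIndependent.pair_iff.2 hcon
      have := hli.fintype_card_le_finrank
      simp [h] at this
    have hfx := congrArg f hab
    rw [map_add, map_smul, map_smul, hy, smul_zero, add_zero, map_zero, smul_eq_mul,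
      mul_eq_zero, or_iff_left hf] at hfx
    rw [hfx, zero_smul, zero_add] at hab
    refine hy0 ((forall_dual_apply_eq_zero_iff A y).1 fun g => ?_)
    have hg := congrArg g hab
    rw [map_smul, map_zero, smul_eq_mul, mul_eq_zero] at hg
    exact hg.resolve_left fun hb => hne ⟨hfx, hb⟩
  let I : Ideal A := LinearMap.range f
  obtain ⟨J, hJ⟩ := Ideal.dvd_span_singleton.2 (LinearMap.mem_range_self f x : f x ∈ I)
  have := Ideal.invertible_of_mul_eq_span_singleton hf hJ.symm
  exact .congr (LinearEquiv.ofInjective f hinj).symm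

end RankOne

section Curve

open TensorProduct KaehlerDifferential

variable {A : Type u} [CommRing A] [IsDomain A] [Algebra ℂ A]

/-- A curve is a finite cover of the affine line: in Noether normalization the number of variables
is the dimension. -/
theorem exists_finite_injective_mvPolynomial_of_ringKrullDim_eq_one [Algebra.FiniteType ℂ A]
    (hdim : ringKrullDim A = 1) :
    ∃ g : MvPolynomial (Fin 1) ℂ →ₐ[ℂ] A, Function.Injective g ∧ g.Finite := by
  obtain ⟨s, g, hg, hfin⟩ := exists_finite_inj_algHom_of_fg ℂ A
  algebraize [g.toRingHom]
  have hint : Algebra.IsIntegral (MvPolynomial (Fin s) ℂ) A := Algebra.isIntegral_def.2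
    (RingHom.Finite.to_isIntegral hfin)
  have hinj : Function.Injective (algebraMap (MvPolynomial (Fin s) ℂ) A) := hg
  have hA : Ring.KrullDimLE 1 A := (Order.krullDimLE_iff _ _).2 hdim.le
  have hP : Ring.KrullDimLE 1 (MvPolynomial (Fin s) ℂ) := by
    rw [Ring.krullDimLE_one_iff_of_noZeroDivisors]
    intro p hp _
    obtain ⟨Q, -, hQ, rfl⟩ := Ideal.exists_ideal_over_prime_of_isIntegral p (⊥ : Ideal A) (by
      rw [← RingHom.ker_eq_comap_bot, (RingHom.injective_iff_ker_eq_bot _).1 hinj]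
      exact bot_le)
    have hQ0 : Q ≠ ⊥ := by
      rintro rfl
      rw [← RingHom.ker_eq_comap_bot, (RingHom.injective_iff_ker_eq_bot _).1 hinj] at hp
      exact hp rfl
    have := Ring.krullDimLE_one_iff_of_noZeroDivisors.1 hA Q hQ0 hQ
    exact Ideal.isMaximal_comap_of_isIntegral_of_isMaximal Q
  have hs : s ≤ 1 := by
    have := (Order.krullDimLE_iff _ _).1 hP
    change ringKrullDim (MvPolynomial (Fin s) ℂ) ≤ _ at this
    rw [MvPolynomial.ringKrullDim_of_isNoetherianRing, ringKrullDim_eq_zero_of_field, zero_add,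
      Nat.card_fin] at this
    exact_mod_cast this
  have hs0 : s ≠ 0 := by
    rintro rfl
    have hf : IsField (MvPolynomial (Fin 0) ℂ) :=
      (MvPolynomial.isEmptyAlgEquiv ℂ (Fin 0)).toMulEquiv.isField (Field.toIsField ℂ)
    have hf : IsField A := isField_of_isIntegral_of_isField' hf
    rw [ringKrullDim_eq_zero_of_isField hf] at hdim
    exact zero_ne_one hdim
  obtain rfl : s = 1 := by omega
  exact ⟨g, hg, hfin⟩

/-- The function field of a curve is separable over that of the affine line which it covers, so that
both have the same differentials. -/
theorem finrank_kaehlerDifferential_of_ringKrullDim_eq_one [Algebra.FiniteType ℂ A]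
    (hdim : ringKrullDim A = 1) : finrank A Ω[A⁄ℂ] = 1 := by
  obtain ⟨g, hg, hfin⟩ := exists_finite_injective_mvPolynomial_of_ringKrullDim_eq_one hdim
  let P := MvPolynomial (Fin 1) ℂ
  let K := FractionRing A
  let L := FractionRing P
  algebraize [g.toRingHom]
  have : FaithfulSMul P A := (faithfulSMul_iff_algebraMap_injective _ _).2 hg
  let : Algebra L K := FractionRing.liftAlgebra P K
  have : IsScalarTower P L K := FractionRing.isScalarTower_liftAlgebra P K
  have : Algebra.IsIntegral P A := Algebra.isIntegral_def.2 (RingHom.Finite.to_isIntegral hfin)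
  have : Algebra.IsAlgebraic P K := (IsFractionRing.isAlgebraic_iff' P A K).1 inferInstance
  have : Algebra.IsAlgebraic L K := IsFractionRing.comap_isAlgebraic_iff.1 this
  have : Algebra.FormallyEtale P L := Algebra.FormallyEtale.of_isLocalization (nonZeroDivisors P)
  have : Algebra.FormallyEtale A K := Algebra.FormallyEtale.of_isLocalization (nonZeroDivisors A)
  have : Algebra.FormallyEtale L K := Algebra.FormallyEtale.of_isSeparable L K
  have : Algebra.FormallyEtale P K := Algebra.FormallyEtale.comp P L K
  have h := ((tensorKaehlerEquivOfFormallyEtale ℂ A K).trans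
    (tensorKaehlerEquivOfFormallyEtale ℂ P K).symm).finrank_eq
  rwa [(TensorProduct.isBaseChange A Ω[A⁄ℂ] K).finrank_eq,
    (TensorProduct.isBaseChange P Ω[P⁄ℂ] K).finrank_eq,
    finrank_eq_card_basis (mvPolynomialBasis ℂ (Fin 1)), Fintype.card_fin] at h

/-- The cotangent space at a point of a smooth variety embeds in the fibre of the differentials,
since the residue field is formally smooth over `ℂ`. -/
theorem finrank_cotangentSpace_atPrime [Algebra.Smooth ℂ A] (p : Ideal A) [p.IsPrime] :
    finrank (IsLocalRing.ResidueField (Localization.AtPrime p))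
      (IsLocalRing.CotangentSpace (Localization.AtPrime p)) ≤ finrank A Ω[A⁄ℂ] := by
  let S := Localization.AtPrime p
  let k := p.ResidueField
  have : Algebra.FormallyEtale A S := Algebra.FormallyEtale.of_isLocalization p.primeCompl
  have : Algebra.FormallySmooth ℂ S := Algebra.FormallySmooth.comp ℂ A S
  have : Algebra.EssFiniteType ℂ k := Algebra.EssFiniteType.comp ℂ A k
  have hsurj : Function.Surjective (algebraMap S k) := IsLocalRing.residue_surjective
  have hinj := (Algebra.FormallySmooth.kerCotangentToTensor_injective_iff (R := ℂ) hsurj).2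
    inferInstance
  have e : k ⊗[S] Ω[S⁄ℂ] ≃ₗ[k] p.Fiber Ω[A⁄ℂ] :=
    (AlgebraTensorModule.congr (LinearEquiv.refl k k)
      (tensorKaehlerEquivOfFormallyEtale ℂ A S).symm).trans
      (AlgebraTensorModule.cancelBaseChange A S k k Ω[A⁄ℂ])
  rw [← p.finrank_fiber_eq_finrank, ← e.finrank_eq]
  have hker : RingHom.ker (algebraMap S k) = IsLocalRing.maximalIdeal S :=
    IsLocalRing.ker_residue
  obtain ⟨f, hf⟩ : ∃ f : IsLocalRing.CotangentSpace S →ₗ[S] k ⊗[S] Ω[S⁄ℂ],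
      Function.Injective f := by
    change ∃ f : (IsLocalRing.maximalIdeal S).Cotangent →ₗ[S] k ⊗[S] Ω[S⁄ℂ], Function.Injective f
    rw [← hker]
    exact ⟨_, hinj⟩
  exact LinearMap.finrank_le_finrank_of_injective
    (f := (f.extendScalarsOfSurjective hsurj : IsLocalRing.CotangentSpace S →ₗ[k] _)) hf

theorem isDedekindDomain_of_smooth [Algebra.Smooth ℂ A]
    (hdim : ringKrullDim A = 1) : IsDedekindDomain A := by
  have : IsNoetherianRing A := Algebra.FiniteType.isNoetherianRing ℂ A
  have : IsDedekindDomainDvr A :=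
    { is_dvr_at_nonzero_prime := fun p hp _ => by
        have h := (finrank_cotangentSpace_atPrime p).trans_eq
          (finrank_kaehlerDifferential_of_ringKrullDim_eq_one hdim)
        have hnf := IsLocalization.AtPrime.not_isField A hp (Localization.AtPrime p)
        exact ((IsDiscreteValuationRing.TFAE _ hnf).out 0 5).2 (h.antisymm
          (Nat.one_le_iff_ne_zero.2 fun h0 =>
            hnf (IsLocalRing.finrank_cotangentSpace_eq_zero_iff.1 h0))) }
  infer_instance

theorem invertible_derivation_of_smooth [Algebra.Smooth ℂ A]
    (hdim : ringKrullDim A = 1) : Module.Invertible A (Derivation ℂ A A) := by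
  have := isDedekindDomain_of_smooth hdim
  have : Module.Invertible A Ω[A⁄ℂ] := .of_finrank_eq_one
    (finrank_kaehlerDifferential_of_ringKrullDim_eq_one hdim)
  exact .congr (linearMapEquivDerivation ℂ A : Dual A Ω[A⁄ℂ] ≃ₗ[A] Derivation ℂ A A)

end Curve

end

theorem proposition2p1 (A : Type u) [CommRing A] [IsDomain A] [Algebra ℂ A] [Algebra.Smooth ℂ A]
    (hdim : ringKrullDim A = 1)
    (F : Ideal (CotangentRing A)) (hF : F ≠ ⊥) (I : Ideal A) (hI : I ≠ ⊥) :
    ∃ (_ : Module.Finite (CotangentRing A) F)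
      (_ : Module.Invertible (CotangentRing A)
        (Module.Dual (CotangentRing A) (Module.Dual (CotangentRing A) F)))
      (_ : Module.Invertible (CotangentRing A) (I.map (algebraMap A (CotangentRing A)))),
      List.TFAE [
        G0.mk (CotangentRing A) F =
          G0.mk (CotangentRing A) (I.map (algebraMap A (CotangentRing A))),
        K0.mk (CotangentRing A)
            (Module.Dual (CotangentRing A) (Module.Dual (CotangentRing A) F)) =
          K0.mk (CotangentRing A) (I.map (algebraMap A (CotangentRing A))),
        CommRing.Pic.mk (CotangentRing A)
            (Module.Dual (CotangentRing A) (Module.Dual (CotangentRing A) F)) =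
          CommRing.Pic.mk (CotangentRing A) (I.map (algebraMap A (CotangentRing A))),
        ∃ φ : F →ₗ[CotangentRing A] I.map (algebraMap A (CotangentRing A)),
          Function.Injective φ ∧
            Module.Finite ℂ ((I.map (algebraMap A (CotangentRing A))) ⧸ LinearMap.range φ)] := by
  have := isDedekindDomain_of_smooth hdim
  have := invertible_derivation_of_smooth hdim
  have hA : ¬ IsField A := fun h =>
    zero_ne_one ((ringKrullDim_eq_zero_of_isField h).symm.trans hdim)
  have : IsJacobsonRing A := isJacobsonRing_of_finiteType (A := ℂ)
  have : IsLocallyFactorial (CotangentRing A) := SymmetricAlgebra.isLocallyFactorial hA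
  have : Algebra.FiniteType ℂ (CotangentRing A) :=
    Algebra.FiniteType.trans (S := A) inferInstance inferInstance
  obtain ⟨a, ha, ha0⟩ := Submodule.exists_mem_ne_zero_of_ne_bot hI
  obtain ⟨J, hJ⟩ := Ideal.dvd_span_singleton.2 ha
  refine tfae_of_isLocallyFactorial (fun m _ => SymmetricAlgebra.height_of_isMaximal hA m)
    (fun m _ => SymmetricAlgebra.G0_mk_quotient_eq_zero m) F hF _
    (J.map (algebraMap A (CotangentRing A))) (c := algebraMap A (CotangentRing A) a) ?_ ?_
  · rwa [Ne, SymmetricAlgebra.algebraMap_eq_zero_iff]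
  · rw [← Ideal.map_mul, ← hJ, Ideal.map_span, Set.image_singleton]
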